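/- Let $W$ be a random variable with values in $(0,1)$, let $W_1,W_2,\dots$ be independent copies of $W$, and put $T_0:=1$, $T_k:=W_1W_2\cdots W_k$ for $k\ge 1$. Let $U_1,U_2,\dots$ be independent random variables with the uniform law on $[0,1]$, independent of the sequence $(W_k)_{k\ge1}$. In the Bernoulli sieve the `balls' $U_1,U_2,\dots$ are allocated over the `boxes' $(T_k,T_{k-1}]$, $k=1,2,\dots$. When the first $n$ balls have been allocated, let $K_n$ be the number of occupied boxes (those that contain at least one of these balls), let $M_n$ be the largest index of an occupied box, and let $L_n:=M_n-K_n$ be the number of empty boxes within the occupancy range. Suppose that $\mathbb{E}|\log W|=\infty$ and that, for some $c\in(0,\infty)$, $$\lim_{n\to\infty}\frac{\mathbb{E}W^n}{\mathbb{E}(1-W)^n}=c.$$ Then, as $n\to\infty$, $L_n$ converges in distribution to a random variable $L$ with the geometric law with success probability $1/(c+1)$, that is, $$\mathbb{P}\{L=m\}=\frac{1}{c+1}\left(\frac{c}{c+1}\right)^m,\qquad m=0,1,2,\dots.$$ In particular, if $\mathbb{E}|\log W|=\infty$, the same conclusion holds whenever, for some $c\in(0,\infty)$, $$\lim_{x\downarrow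 0}\frac{\mathbb{P}\{1-W\le x\}}{\mathbb{P}\{W\le x\}}=c.$$ -/

import Mathlib

open MeasureTheory ProbabilityTheory Filter Topology
open scoped ENNReal

namespace BernoulliSieve

/-- The multiplicative walk `T_0 = 1`, `T_k = W_1 ⋯ W_k`; here `w i` stands for `W_{i+1}`. -/
noncomputable def T (w : ℕ → ℝ) (k : ℕ) : ℝ := ∏ i ∈ Finset.range k, w i

/-- The box with index `k ≥ 1` is the interval `(T_k, T_{k-1}]`. -/
def box (w : ℕ → ℝ) (k : ℕ) : Set ℝ := Set.Ioc (T w k) (T w (k - 1))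

/-- The set of indices `k ≥ 1` of the boxes that contain at least one of the first `n` balls;
`u i` is the position of the ball with number `i + 1`. -/
def occupied (w u : ℕ → ℝ) (n : ℕ) : Set ℕ := {k | 1 ≤ k ∧ ∃ i < n, u i ∈ box w k}

/-- `K_n`, the number of occupied boxes. -/
noncomputable def numOccupied (w u : ℕ → ℝ) (n : ℕ) : ℕ := (occupied w u n).ncard

/-- `M_n`, the index of the last occupied box (`0` when there is none, as for `n = 0`). -/
noncomputable def lastOccupied (w u : ℕ → ℝ) (n : ℕ) : ℕ := sSup (occupied w u n)

/-- The indices are at least one, so the subtraction in `M_n - K_n` never truncates. -/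
theorem numOccupied_le_lastOccupied (w u : ℕ → ℝ) (n : ℕ) :
    numOccupied w u n ≤ lastOccupied w u n := by
  unfold numOccupied lastOccupied
  by_cases hf : (occupied w u n).Finite
  · have hsub : occupied w u n ⊆ ↑(Finset.Icc 1 (sSup (occupied w u n))) := by
      intro k hk
      simp only [Finset.coe_Icc, Set.mem_Icc]
      exact ⟨hk.1, le_csSup hf.bddAbove hk⟩
    have h := Set.ncard_le_ncard hsub (Finset.finite_toSet _)
    rw [Set.ncard_coe_finset] at h
    simpa using h
  · rw [Set.Infinite.ncard hf]
    exact Nat.zero_le _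

/-- `L_n = M_n - K_n`, the number of empty boxes within the occupancy range. -/
noncomputable def numEmpty (w u : ℕ → ℝ) (n : ℕ) : ℕ := lastOccupied w u n - numOccupied w u n

/-- The random input of the Bernoulli sieve generated by the random variable `W` with values in
`(0, 1)`: the factors `Wseq 0, Wseq 1, …` are independent copies of `W`, the balls
`U 0, U 1, …` are independent and uniform on `[0, 1]`, and the two sequences are independent. -/
structure IsBernoulliSieve {Ω₀ Ω : Type*} [MeasurableSpace Ω₀] [MeasurableSpace Ω]
    (P₀ : Measure Ω₀) (W : Ω₀ → ℝ) (P : Measure Ω) (Wseq U : ℕ → Ω → ℝ) : Prop where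
  measurable_W : Measurable W
  mem_Ioo : ∀ᵐ ω ∂P₀, W ω ∈ Set.Ioo (0 : ℝ) 1
  measurable_Wseq : ∀ k, Measurable (Wseq k)
  identDistrib : ∀ k, IdentDistrib (Wseq k) W P P₀
  indep_Wseq : iIndepFun Wseq P
  measurable_U : ∀ k, Measurable (U k)
  uniform_U : ∀ k, pdf.IsUniform (U k) (Set.Icc (0 : ℝ) 1) P volume
  indep_U : iIndepFun U P
  indep_Wseq_U : IndepFun (fun ω k => Wseq k ω) (fun ω k => U k ω) P

/-- The success probability `1 / (c + 1)` as an element of `[0, 1]`. -/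
noncomputable def successProb (c : ℝ) (hc : 0 < c) : unitInterval :=
  ⟨1 / (c + 1), by positivity, (div_le_one (by linarith)).2 (by linarith)⟩

end BernoulliSieve

/-!
The argument follows the balls that remain. After `j` boxes the set of remaining balls is
`A_j = {i < n | u_i ≤ T_j}`, and given the past a state with `k ≥ 1` remaining balls has two special
transitions: no ball falls into the next box (probability `a_k = E W^k`; the box is then empty and
inside the occupancy range), or all of them do (probability `b_k = E (1-W)^k`; the range ends).
So `L_n` counts the transitions of the first kind before the first one of the second kind, and where
`k` is large, `a_k ≈ c * b_k` makes each special transition of the first kind with probability about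
`c / (c + 1)`: the count is geometric. It remains to see that states with few balls do not matter.

* The comparison with the geometric law (`evalAt`, `IsBernoulliSieve.exists_sum_drift_le`). For bounded
  `F` let `H l` be the mean of `F (l + G)` with `G` geometric, and evaluate the state after `j` boxes,
  with `l` empty boxes seen, as `H l` while balls remain and as `F l` afterwards. The memoryless
  property of `G` (`geomShift_rec`) makes the drift of this process in the state `A_j` a bounded
  multiple of `a_k - c * b_k`, `k = |A_j|`. For large `k` this is small relative to `b_k`, and the sum
  of `b_k` over all visited states is at most one in mean (`IsBernoulliSieve.sum_exit_le_one`).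
* Rare visits to small states (`IsBernoulliSieve.exists_sum_measure_remaining_le`). For fixed `k ≥ 1`
  the mean number of `j` with `|A_j| = k` is at most a constant times `Φ n = ∑ j, E f(n T_j)`, where
  `f x = e^{-x/2} - e^{-x}` (`bump`).
* `Φ x → 0` as `x → ∞` (`tendsto_potential_bump`); here `E|log W| = ∞` is needed. If
  `s_0 ≤ 1` and `s_{i+1} ≤ s_i / 2`, telescoping `e^{-xW} - e^{-x}` over the scales `s_i` gives
  `∑ i, P(W ≤ s_{i+1}) * Φ (s_i x) ≤ 1`. Let `η` be the upper limit of `Φ`. The renewal equation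
  `Φ x = f x + E Φ(x W)` shows that near-maximal points stay near-maximal, in mean, when multiplied
  by `W`; hence one can choose `s_i ≥ r^i` with `Φ (s_i x) ≥ η / 2`, and since `∑ i, P(W ≤ r^(i+1))`
  diverges, `η = 0`.

The condition on the tails implies the one on the moments by integration by parts
(`tendsto_moment_ratio_of_tendsto_tail_ratio`).
-/

open MeasureTheory ProbabilityTheory Filter Topology
open scoped ENNReal

namespace BernoulliSieve

/-! ### The renewal operator -/

/-- The transition operator `g ↦ (x ↦ E g(x W))` of the multiplicative walk, where `ν` is the law of
`W`; its `j`-th iterate is `g ↦ (x ↦ E g(x T_j))`. -/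
noncomputable def avg (ν : Measure ℝ) (g : ℝ → ℝ≥0∞) (x : ℝ) : ℝ≥0∞ := ∫⁻ w, g (x * w) ∂ν

/-- The potential `g ↦ (x ↦ ∑ j, E g(x T_j))` of the multiplicative walk. -/
noncomputable def potential (ν : Measure ℝ) (g : ℝ → ℝ≥0∞) (x : ℝ) : ℝ≥0∞ :=
  ∑' j : ℕ, (avg ν)^[j] g x

variable {ν : Measure ℝ}

lemma measurable_avg [SFinite ν] {g : ℝ → ℝ≥0∞} (hg : Measurable g) : Measurable (avg ν g) := by
  unfold avg
  exact Measurable.lintegral_prod_right' (f := fun p : ℝ × ℝ => g (p.1 * p.2)) (by fun_prop)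

lemma measurable_iterate_avg [SFinite ν] {g : ℝ → ℝ≥0∞} (hg : Measurable g) (j : ℕ) :
    Measurable ((avg ν)^[j] g) := by
  induction j with
  | zero => simpa
  | succ j ih => rw [Function.iterate_succ_apply']; exact measurable_avg ih

lemma measurable_potential [SFinite ν] {g : ℝ → ℝ≥0∞} (hg : Measurable g) :
    Measurable (potential ν g) :=
  Measurable.tsum fun j => measurable_iterate_avg hg j

lemma iterate_avg_mono {g h : ℝ → ℝ≥0∞} (hgh : ∀ x, g x ≤ h x) (j : ℕ) (x : ℝ) :
    (avg ν)^[j] g x ≤ (avg ν)^[j] h x := by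
  induction j generalizing x with
  | zero => exact hgh x
  | succ j ih =>
    rw [Function.iterate_succ_apply', Function.iterate_succ_apply']
    exact lintegral_mono fun w => ih _

lemma iterate_avg_add [SFinite ν] {g h : ℝ → ℝ≥0∞} (hg : Measurable g) (j : ℕ) (x : ℝ) :
    (avg ν)^[j] (fun y => g y + h y) x = (avg ν)^[j] g x + (avg ν)^[j] h x := by
  induction j generalizing x with
  | zero => rfl
  | succ j ih =>
    simp only [Function.iterate_succ_apply']
    unfold avg at ih ⊢
    simp only [ih]
    exact lintegral_add_left ((measurable_iterate_avg hg j).comp (measurable_const_mul x)) _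

lemma iterate_avg_const_mul [SFinite ν] {g : ℝ → ℝ≥0∞} (hg : Measurable g) (γ : ℝ≥0∞) (j : ℕ)
    (x : ℝ) : (avg ν)^[j] (fun y => γ * g y) x = γ * (avg ν)^[j] g x := by
  induction j generalizing x with
  | zero => rfl
  | succ j ih =>
    simp only [Function.iterate_succ_apply']
    unfold avg at ih ⊢
    simp only [ih]
    exact lintegral_const_mul _ ((measurable_iterate_avg hg j).comp (measurable_const_mul x))

lemma iterate_avg_scale (g : ℝ → ℝ≥0∞) (s : ℝ) (j : ℕ) (x : ℝ) :
    (avg ν)^[j] (fun y => g (s * y)) x = (avg ν)^[j] g (s * x) := by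
  induction j generalizing x with
  | zero => rfl
  | succ j ih =>
    simp only [Function.iterate_succ_apply']
    unfold avg at ih ⊢
    simp only [ih, mul_assoc]

lemma iterate_avg_zero (j : ℕ) (x : ℝ) : (avg ν)^[j] (fun _ => 0) x = 0 := by
  induction j generalizing x with
  | zero => rfl
  | succ j ih =>
    simp only [Function.iterate_succ_apply']
    unfold avg at ih ⊢
    simp [ih]

lemma iterate_avg_sum [SFinite ν] {N : ℕ} {g : ℕ → ℝ → ℝ≥0∞} (hg : ∀ i, Measurable (g i)) (j : ℕ)
    (x : ℝ) : (avg ν)^[j] (fun y => ∑ i ∈ Finset.range N, g i y) x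
      = ∑ i ∈ Finset.range N, (avg ν)^[j] (g i) x := by
  induction N with
  | zero => simp [iterate_avg_zero]
  | succ N ih =>
    simp only [Finset.sum_range_succ]
    rw [iterate_avg_add (Finset.measurable_sum _ fun i _ => hg i), ih]

lemma potential_eq_add_avg [SFinite ν] {g : ℝ → ℝ≥0∞} (hg : Measurable g) (x : ℝ) :
    potential ν g x = g x + avg ν (potential ν g) x := by
  unfold potential
  rw [tsum_eq_zero_add' ENNReal.summable]
  simp only [Function.iterate_succ_apply', Function.iterate_zero, id]
  congr 1
  unfold avg
  exact (lintegral_tsum fun j =>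
    ((measurable_iterate_avg hg j).comp (measurable_const_mul x)).aemeasurable).symm

/-- A superharmonic function dominates the potential of its defect. -/
lemma potential_le [SFinite ν] {q A : ℝ → ℝ≥0∞} (hq : Measurable q)
    (h : ∀ x, q x + avg ν A x ≤ A x) (x : ℝ) : potential ν q x ≤ A x := by
  have key : ∀ J : ℕ, ∑ j ∈ Finset.range J, (avg ν)^[j] q x + (avg ν)^[J] A x ≤ A x := by
    intro J
    induction J with
    | zero => simp
    | succ J ih =>
      refine le_trans ?_ ih
      rw [Finset.sum_range_succ, add_assoc, Function.iterate_succ_apply]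
      gcongr
      rw [← iterate_avg_add hq]
      exact iterate_avg_mono h J x
  exact ENNReal.tsum_le_of_sum_range_le fun J => le_self_add.trans (key J)

lemma potential_weighted_sum [SFinite ν] {f : ℝ → ℝ≥0∞} (hf : Measurable f) (γ : ℕ → ℝ≥0∞)
    (s : ℕ → ℝ) (N : ℕ) (x : ℝ) :
    potential ν (fun y => ∑ i ∈ Finset.range N, γ i * f (s i * y)) x
      = ∑ i ∈ Finset.range N, γ i * potential ν f (s i * x) := by
  unfold potential
  simp_rw [← ENNReal.tsum_mul_left]
  rw [← Summable.tsum_finsetSum fun i _ => ENNReal.summable]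
  refine tsum_congr fun j => ?_
  rw [iterate_avg_sum (fun i => by fun_prop)]
  refine Finset.sum_congr rfl fun i _ => ?_
  rw [iterate_avg_const_mul (by fun_prop), iterate_avg_scale]

/-! ### The key renewal theorem for infinite mean -/

/-- The test function `e^{-x/2} - e^{-x}`; it vanishes for `x ≤ 0`. -/
noncomputable def bump (x : ℝ) : ℝ≥0∞ := ENNReal.ofReal (Real.exp (-(x / 2)) - Real.exp (-x))

@[fun_prop]
lemma measurable_bump : Measurable bump := by unfold bump; fun_prop

lemma bump_of_nonpos {x : ℝ} (hx : x ≤ 0) : bump x = 0 := by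
  unfold bump
  rw [ENNReal.ofReal_eq_zero, sub_nonpos, Real.exp_le_exp]
  linarith

/-- Over a sequence that at least halves at each step, the bumps at the scales above `w` telescope
to the defect of `1 - e^{-x}` under `x ↦ x w`. -/
lemma sum_bump_le {s : ℕ → ℝ} (hs0 : s 0 ≤ 1) (hpos : ∀ i, 0 < s i)
    (hs : ∀ i, s (i + 1) ≤ s i / 2) {w : ℝ} (hw : w ∈ Set.Ioo (0 : ℝ) 1) (N : ℕ) (x : ℝ) :
    ∑ i ∈ Finset.range N, (Set.Iic (s (i + 1))).indicator 1 w * bump (s i * x)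
      + ENNReal.ofReal (1 - Real.exp (-(x * w))) ≤ ENNReal.ofReal (1 - Real.exp (-x)) := by
  obtain ⟨hw0, hw1⟩ := hw
  rcases le_or_gt x 0 with hx | hx
  · rw [Finset.sum_eq_zero, zero_add]
    · rw [ENNReal.ofReal_of_nonpos]
      · exact zero_le
      · rw [sub_nonpos, Real.one_le_exp_iff]; nlinarith
    · intro i _
      rw [bump_of_nonpos (mul_nonpos_of_nonneg_of_nonpos (hpos i).le hx), mul_zero]
  have key : ∀ N : ℕ, ∑ i ∈ Finset.range N, (Set.Iic (s (i + 1))).indicator 1 w * bump (s i * x)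
      ≤ ENNReal.ofReal (Real.exp (-(x * max w (s N))) - Real.exp (-x)) := by
    intro N
    induction N with
    | zero => simp
    | succ N ih =>
      rw [Finset.sum_range_succ]
      by_cases hwN : w ≤ s (N + 1)
      · have h1 : w ≤ s N := by linarith [hs N, hpos N]
        rw [max_eq_right h1] at ih
        rw [max_eq_right hwN, Set.indicator_of_mem (by simpa using hwN), Pi.one_apply, one_mul]
        have h2 : s N ≤ 1 := by
          have : ∀ m, s m ≤ 1 := by
            intro m
            induction m with
            | zero => exact hs0
            | succ m ihm => linarith [hs m, hpos m]
          exact this N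
        refine (add_le_add_left ih _).trans ?_
        unfold bump
        rw [← ENNReal.ofReal_add]
        · apply ENNReal.ofReal_le_ofReal
          have : Real.exp (-(s N * x / 2)) ≤ Real.exp (-(x * s (N + 1))) := by
            rw [Real.exp_le_exp]; nlinarith [hs N]
          rw [mul_comm (s N) x] at this ⊢
          linarith
        · rw [sub_nonneg, Real.exp_le_exp]; nlinarith
        · rw [sub_nonneg, Real.exp_le_exp]; nlinarith [mul_pos (hpos N) hx]
      · rw [Set.indicator_of_notMem (by simpa using hwN), zero_mul, add_zero]
        refine ih.trans (ENNReal.ofReal_le_ofReal ?_)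
        have : Real.exp (-(x * max w (s N))) ≤ Real.exp (-(x * max w (s (N + 1)))) := by
          rw [Real.exp_le_exp]
          have : max w (s (N + 1)) ≤ max w (s N) :=
            max_le_max le_rfl (by linarith [hs N, hpos N])
          nlinarith
        linarith
  refine (add_le_add_left (key N) _).trans ?_
  have h1 : Real.exp (-(x * max w (s N))) ≤ Real.exp (-(x * w)) := by
    rw [Real.exp_le_exp]; nlinarith [le_max_left w (s N)]
  have h2 : Real.exp (-(x * w)) ≤ 1 := by
    rw [Real.exp_le_one_iff]; nlinarith
  refine (add_le_add_left (ENNReal.ofReal_le_ofReal (sub_le_sub_right h1 _)) _).trans ?_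
  rw [← ENNReal.ofReal_add]
  · apply ENNReal.ofReal_le_ofReal; linarith
  · rw [sub_nonneg, Real.exp_le_exp]; nlinarith
  · linarith

/-- `1 - e^{-x}` decreases along the walk from a value at most `1` to `0`, so the total of its mean
decrements is bounded; by `sum_bump_le` each decrement dominates a sum of bumps over the scales
`s i`. -/
lemma sum_mul_potential_bump_le_one [IsProbabilityMeasure ν] (hν : ∀ᵐ w ∂ν, w ∈ Set.Ioo (0 : ℝ) 1)
    {s : ℕ → ℝ} (hs0 : s 0 ≤ 1) (hpos : ∀ i, 0 < s i) (hs : ∀ i, s (i + 1) ≤ s i / 2) (N : ℕ)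
    (x : ℝ) :
    ∑ i ∈ Finset.range N, ν (Set.Iic (s (i + 1))) * potential ν bump (s i * x) ≤ 1 := by
  rw [← potential_weighted_sum measurable_bump (fun i => ν (Set.Iic (s (i + 1)))) s]
  refine (potential_le (A := fun x => ENNReal.ofReal (1 - Real.exp (-x)))
    (Finset.measurable_sum _ fun i _ => by fun_prop) (fun y => ?_) x).trans ?_
  · unfold avg
    calc _ = ∫⁻ w, (∑ i ∈ Finset.range N, (Set.Iic (s (i + 1))).indicator 1 w * bump (s i * y)
          + ENNReal.ofReal (1 - Real.exp (-(y * w)))) ∂ν := by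
          rw [lintegral_add_right _ (by fun_prop), lintegral_finsetSum]
          · congr 1
            refine Finset.sum_congr rfl fun i _ => ?_
            rw [lintegral_mul_const _ (measurable_one.indicator measurableSet_Iic),
              lintegral_indicator_one measurableSet_Iic]
          · intro i _
            exact (measurable_one.indicator measurableSet_Iic).mul_const _
      _ ≤ ∫⁻ _, ENNReal.ofReal (1 - Real.exp (-y)) ∂ν :=
          lintegral_mono_ae (hν.mono fun w hw => sum_bump_le hs0 hpos hs hw N y)
      _ = _ := by simp
  · rw [ENNReal.ofReal_le_one]
    linarith [Real.exp_pos (-x)]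

/-- If `E|log W| = ∞`, then `W` has mass arbitrarily close to `0`. -/
lemma measure_Iic_pos [IsProbabilityMeasure ν] (hν : ∀ᵐ w ∂ν, w ∈ Set.Ioo (0 : ℝ) 1)
    (hlog : ∫⁻ w, ENNReal.ofReal |Real.log w| ∂ν = ∞) {x : ℝ} (hx : 0 < x) :
    0 < ν (Set.Iic x) := by
  rw [pos_iff_ne_zero]
  intro h0
  have h1 : ∀ᵐ w ∂ν, x < w := by
    rw [ae_iff]; convert h0 using 2; ext; simp
  have : ∫⁻ w, ENNReal.ofReal |Real.log w| ∂ν ≤ ∫⁻ _, ENNReal.ofReal (-Real.log x) ∂ν := by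
    refine lintegral_mono_ae ?_
    filter_upwards [hν, h1] with w hw hxw
    apply ENNReal.ofReal_le_ofReal
    rw [abs_of_neg (Real.log_neg hw.1 hw.2)]
    linarith [Real.log_le_log hx hxw.le]
  rw [hlog] at this
  simp at this

/-- `∑ P(W ≤ r^(i+1))` diverges when `E|log W| = ∞`, because `|log W| / |log r|` exceeds the number
of powers of `r` above `W` by at most one. -/
lemma tsum_measure_Iic_pow [IsProbabilityMeasure ν] (hν : ∀ᵐ w ∂ν, w ∈ Set.Ioo (0 : ℝ) 1)
    (hlog : ∫⁻ w, ENNReal.ofReal |Real.log w| ∂ν = ∞) {r : ℝ} (hr0 : 0 < r) (hr1 : r < 1) :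
    ∑' i : ℕ, ν (Set.Iic (r ^ (i + 1))) = ∞ := by
  have hd : 0 < -Real.log r := by linarith [Real.log_neg hr0 hr1]
  have key : ∀ w ∈ Set.Ioo (0 : ℝ) 1, ENNReal.ofReal |Real.log w| ≤ ENNReal.ofReal (-Real.log r) *
      (1 + ∑' i : ℕ, (Set.Iic (r ^ (i + 1))).indicator (1 : ℝ → ℝ≥0∞) w) := by
    intro w hw
    have hlw : 0 < -Real.log w := by linarith [Real.log_neg hw.1 hw.2]
    set N : ℕ := ⌊-Real.log w / -Real.log r⌋₊ with hN
    have hle : (N : ℝ) ≤ -Real.log w / -Real.log r := Nat.floor_le (by positivity)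
    have hlt : -Real.log w / -Real.log r < N + 1 := Nat.lt_floor_add_one _
    have hsum : (N : ℝ≥0∞) ≤ ∑' i : ℕ, (Set.Iic (r ^ (i + 1))).indicator (1 : ℝ → ℝ≥0∞) w := by
      refine le_trans ?_ (ENNReal.sum_le_tsum (Finset.range N))
      rw [Finset.sum_congr rfl (g := fun _ => (1 : ℝ≥0∞))]
      · simp
      · intro i hi
        rw [Set.indicator_of_mem]
        · rfl
        · rw [Set.mem_Iic, ← Real.log_le_log_iff hw.1 (by positivity), Real.log_pow]
          rw [le_div_iff₀ hd] at hle
          have hi' : ((i + 1 : ℕ) : ℝ) ≤ N := by exact_mod_cast Finset.mem_range.1 hi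
          nlinarith
    calc ENNReal.ofReal |Real.log w| ≤ ENNReal.ofReal (-Real.log r * (1 + N)) := by
          apply ENNReal.ofReal_le_ofReal
          rw [abs_of_neg (by linarith)]
          rw [div_lt_iff₀ hd] at hlt
          linarith
      _ = ENNReal.ofReal (-Real.log r) * (1 + N) := by
          rw [ENNReal.ofReal_mul hd.le, ENNReal.ofReal_add zero_le_one (by positivity)]
          simp
      _ ≤ _ := by gcongr
  by_contra hfin
  have h1 : ∫⁻ w, ENNReal.ofReal |Real.log w| ∂ν ≤ ENNReal.ofReal (-Real.log r) *
      (1 + ∑' i : ℕ, ν (Set.Iic (r ^ (i + 1)))) := by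
    refine (lintegral_mono_ae (hν.mono key)).trans_eq ?_
    have hm : ∀ i : ℕ, Measurable ((Set.Iic (r ^ (i + 1))).indicator (1 : ℝ → ℝ≥0∞)) :=
      fun i => measurable_one.indicator measurableSet_Iic
    rw [lintegral_const_mul _ (by fun_prop), lintegral_add_left measurable_const,
      lintegral_tsum fun i => (hm i).aemeasurable]
    simp [lintegral_indicator_one measurableSet_Iic]
  rw [hlog, top_le_iff] at h1
  exact ENNReal.mul_ne_top ENNReal.ofReal_ne_top
    (ENNReal.add_ne_top.2 ⟨ENNReal.one_ne_top, hfin⟩) h1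

/-- There is a compact interval below `1/2` that carries mass of `W`. -/
lemma exists_measure_Icc_pos [IsProbabilityMeasure ν] (hν : ∀ᵐ w ∂ν, w ∈ Set.Ioo (0 : ℝ) 1)
    (hlog : ∫⁻ w, ENNReal.ofReal |Real.log w| ∂ν = ∞) :
    ∃ r : ℝ, 0 < r ∧ r < 1 ∧ 0 < ν (Set.Icc r (1 / 2)) := by
  by_contra! hcon
  have h2 : ν (⋃ m : ℕ, Set.Icc (1 / ((m : ℝ) + 2)) (1 / 2)) = 0 := by
    rw [measure_iUnion_null_iff]
    intro m
    have := hcon (1 / ((m : ℝ) + 2)) (by positivity)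
      (by rw [div_lt_one (by positivity)]; linarith [(Nat.cast_nonneg m : (0 : ℝ) ≤ m)])
    exact le_zero_iff.1 this
  have h3 : ν (Set.Iic (1 / 2 : ℝ)) = 0 := by
    rw [← le_zero_iff, ← h2]
    refine measure_mono_ae ?_
    filter_upwards [hν] with w hw hw2
    obtain ⟨m, hm⟩ := exists_nat_gt (1 / w)
    refine Set.mem_iUnion.2 ⟨m, ?_, hw2⟩
    rw [div_le_iff₀ (by positivity)]
    rw [div_lt_iff₀ hw.1] at hm
    nlinarith [hw.1]
  exact (measure_Iic_pos hν hlog (x := 1 / 2) (by norm_num)).ne' h3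

lemma potential_bump_mul_le_one [IsProbabilityMeasure ν]
    (hν : ∀ᵐ w ∂ν, w ∈ Set.Ioo (0 : ℝ) 1) (x : ℝ) :
    ν (Set.Iic (1 / 2 : ℝ)) * potential ν bump x ≤ 1 := by
  have := sum_mul_potential_bump_le_one hν (s := fun i => (1 / 2 : ℝ) ^ i) (by simp)
    (fun i => by positivity) (fun i => by rw [pow_succ]; linarith) 1 x
  simpa using this

lemma potential_bump_le [IsProbabilityMeasure ν] (hν : ∀ᵐ w ∂ν, w ∈ Set.Ioo (0 : ℝ) 1)
    (hlog : ∫⁻ w, ENNReal.ofReal |Real.log w| ∂ν = ∞) (x : ℝ) :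
    potential ν bump x ≤ (ν (Set.Iic (1 / 2 : ℝ)))⁻¹ := by
  have h0 := (measure_Iic_pos hν hlog (x := 1 / 2) (by norm_num)).ne'
  rw [ENNReal.le_inv_iff_mul_le, mul_comm]
  exact potential_bump_mul_le_one hν x

lemma potential_bump_ne_top [IsProbabilityMeasure ν] (hν : ∀ᵐ w ∂ν, w ∈ Set.Ioo (0 : ℝ) 1)
    (hlog : ∫⁻ w, ENNReal.ofReal |Real.log w| ∂ν = ∞) (x : ℝ) : potential ν bump x ≠ ∞ :=
  ne_top_of_le_ne_top (ENNReal.inv_ne_top.2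
    (measure_Iic_pos hν hlog (x := 1 / 2) (by norm_num)).ne') (potential_bump_le hν hlog x)

/-- Let `ψ` be bounded and almost harmonic at infinity, with upper limit at most `η`. Along a
sequence on which `ψ` gets close to `η`, the value `ψ (x n * W)` also gets close to `η` in mean, so
one can move down by a factor from any interval that carries mass of `W`. -/
lemma exists_step_near_limsup [IsProbabilityMeasure ν] (hν : ∀ᵐ w ∂ν, w ∈ Set.Ioo (0 : ℝ) 1)
    {ψ g : ℝ → ℝ} {B η r : ℝ} (hψm : Measurable ψ) (hψ0 : ∀ x, 0 ≤ ψ x) (hψB : ∀ x, ψ x ≤ B)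
    (hren : ∀ x, ψ x = g x + ∫ w, ψ (x * w) ∂ν) (hg : Tendsto g atTop (𝓝 0))
    (hη : ∀ ε > 0, ∀ᶠ x in atTop, ψ x < η + ε) (hr0 : 0 < r) (hpos : 0 < ν (Set.Icc r (1 / 2)))
    {x : ℕ → ℝ} (hxpos : ∀ n, 0 < x n) (hx : Tendsto x atTop atTop)
    (hxη : ∀ ε > 0, ∀ᶠ n in atTop, η - ε < ψ (x n)) :
    ∃ y : ℕ → ℝ, (∀ n, 0 < y n) ∧ Tendsto y atTop atTop ∧
      (∀ ε > 0, ∀ᶠ n in atTop, η - ε < ψ (y n)) ∧ ∀ n, r * x n ≤ y n ∧ y n ≤ x n / 2 := by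
  have hint : ∀ n, Integrable (fun w => ψ (x n * w)) ν := fun n =>
    Integrable.of_bound (hψm.comp (measurable_const_mul _)).aestronglyMeasurable B
      (ae_of_all _ fun w => by rw [Real.norm_of_nonneg (hψ0 _)]; exact hψB _)
  have hintp : ∀ n, Integrable (fun w => max (ψ (x n * w) - η) 0) ν := fun n =>
    ((hint n).sub (integrable_const η)).pos_part
  have hintm : ∀ n, Integrable (fun w => max (η - ψ (x n * w)) 0) ν := fun n =>
    ((integrable_const η).sub (hint n)).pos_part
  have hplus : Tendsto (fun n => ∫ w, max (ψ (x n * w) - η) 0 ∂ν) atTop (𝓝 0) := by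
    have : Tendsto (fun n => ∫ w, max (ψ (x n * w) - η) 0 ∂ν) atTop (𝓝 (∫ _, (0 : ℝ) ∂ν)) := by
      refine tendsto_integral_of_dominated_convergence (fun _ => B + |η|)
        (fun n => (hintp n).aestronglyMeasurable) (integrable_const _) (fun n => ?_) ?_
      · refine ae_of_all _ fun w => ?_
        rw [Real.norm_of_nonneg (le_max_right _ _)]
        refine max_le ?_ ?_
        · linarith [hψB (x n * w), neg_abs_le η]
        · linarith [(hψ0 0).trans (hψB 0), abs_nonneg η]
      · filter_upwards [hν] with w hw
        rw [Metric.tendsto_atTop']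
        intro ε hε
        have h1 : Tendsto (fun n => x n * w) atTop atTop := hx.atTop_mul_const hw.1
        obtain ⟨n₀, hn₀⟩ := eventually_atTop.1 (h1.eventually (hη ε hε))
        refine ⟨n₀, fun n hn => ?_⟩
        rw [Real.dist_0_eq_abs, abs_of_nonneg (le_max_right _ _), max_lt_iff]
        exact ⟨by linarith [hn₀ n hn.le], hε⟩
    simpa using this
  have hminus : ∀ ε > 0, ∀ᶠ n in atTop, ∫ w, max (η - ψ (x n * w)) 0 ∂ν < ε := by
    intro ε hε
    have h1 := hplus.eventually (gt_mem_nhds (show (0 : ℝ) < ε / 3 by positivity))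
    have h2 := (hg.comp hx).eventually (gt_mem_nhds (show (0 : ℝ) < ε / 3 by positivity))
    filter_upwards [h1, h2, hxη (ε / 3) (by positivity)] with n h1 h2 h3
    have h4 : ∫ w, max (η - ψ (x n * w)) 0 ∂ν
        = η - ∫ w, ψ (x n * w) ∂ν + ∫ w, max (ψ (x n * w) - η) 0 ∂ν := by
      have h5 : ∀ w, max (η - ψ (x n * w)) 0 = (η - ψ (x n * w)) + max (ψ (x n * w) - η) 0 := by
        intro w
        rcases le_total (η - ψ (x n * w)) 0 with h | h
        · rw [max_eq_right h, max_eq_left (by linarith)]; ring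
        · rw [max_eq_left h, max_eq_right (by linarith)]; ring
      simp_rw [h5]
      have hsub : Integrable (fun w => η - ψ (x n * w)) ν := (integrable_const η).sub (hint n)
      rw [integral_add hsub (hintp n), integral_sub (integrable_const η) (hint n)]
      simp
    have h6 := hren (x n)
    simp only [Function.comp_apply] at h2
    linarith
  set p : ℝ := ν.real (Set.Icc r (1 / 2)) with hp
  have hp0 : 0 < p := ENNReal.toReal_pos hpos.ne' (measure_ne_top _ _)
  -- some point of the interval does at least as well as the average over the interval
  have hex : ∀ n, ∃ w ∈ Set.Icc r (1 / 2 : ℝ),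
      η - ψ (x n * w) ≤ (∫ w, max (η - ψ (x n * w)) 0 ∂ν) / p := by
    intro n
    by_contra! hcon
    set I := ∫ w, max (η - ψ (x n * w)) 0 ∂ν with hI
    have h1 : ∫ w in Set.Icc r (1 / 2), (max (η - ψ (x n * w)) 0 - I / p) ∂ν ≤ 0 := by
      rw [integral_sub (hintm n).integrableOn (integrable_const _)]
      have : ∫ w in Set.Icc r (1 / 2), max (η - ψ (x n * w)) 0 ∂ν ≤ I :=
        setIntegral_le_integral (hintm n) (ae_of_all _ fun w => le_max_right _ _)
      have h3 : p * (I / p) = I := by field_simp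
      simp only [setIntegral_const, smul_eq_mul]
      rw [← hp, h3]
      linarith
    have h2 : 0 < ∫ w in Set.Icc r (1 / 2), (max (η - ψ (x n * w)) 0 - I / p) ∂ν := by
      rw [setIntegral_pos_iff_support_of_nonneg_ae]
      · refine hpos.trans_le (measure_mono fun w hw => ⟨?_, hw⟩)
        have := hcon w hw
        rw [Function.mem_support]
        have h5 := le_max_left (η - ψ (x n * w)) 0
        linarith
      · refine (ae_restrict_iff' measurableSet_Icc).2 (ae_of_all _ fun w hw => ?_)
        have h5 := le_max_left (η - ψ (x n * w)) 0
        have := hcon w hw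
        simp only [Pi.zero_apply]
        linarith
      · exact ((hintm n).sub (integrable_const _)).integrableOn
    linarith
  choose w hw hwle using hex
  have hlow : ∀ n, r * x n ≤ x n * w n := fun n => by
    rw [mul_comm]; exact mul_le_mul_of_nonneg_left (hw n).1 (hxpos n).le
  refine ⟨fun n => x n * w n, fun n => mul_pos (hxpos n) (hr0.trans_le (hw n).1),
    tendsto_atTop_mono hlow (hx.const_mul_atTop hr0), fun ε hε => ?_, fun n => ⟨hlow n, ?_⟩⟩
  · filter_upwards [hminus (ε * p) (by positivity)] with n hn
    have h1 := hwle n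
    have h2 : (∫ w, max (η - ψ (x n * w)) 0 ∂ν) / p < ε := by rwa [div_lt_iff₀ hp0]
    linarith
  · have := mul_le_mul_of_nonneg_left (hw n).2 (hxpos n).le
    linarith

lemma tendsto_bump : Tendsto (fun x => (bump x).toReal) atTop (𝓝 0) := by
  have h1 : Tendsto (fun x : ℝ => Real.exp (-(x / 2)) - Real.exp (-x)) atTop (𝓝 (0 - 0)) :=
    (Real.tendsto_exp_neg_atTop_nhds_zero.comp (tendsto_id.atTop_div_const (by norm_num))).sub
      Real.tendsto_exp_neg_atTop_nhds_zero
  rw [sub_zero] at h1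
  refine h1.congr' ?_
  filter_upwards [eventually_ge_atTop 0] with x hx
  unfold bump
  rw [ENNReal.toReal_ofReal]
  rw [sub_nonneg, Real.exp_le_exp]
  linarith

/-- The key renewal theorem for `E|log W| = ∞`, for one test function. If the upper limit `η` were
positive, it would be attained, up to a factor `2`, along a sequence of scales with ratios bounded
below, and `sum_mul_potential_bump_le_one` would bound the divergent series
`∑ i, η / 2 * P(W ≤ r ^ (i + 1))` by one. -/
theorem tendsto_potential_bump [IsProbabilityMeasure ν] (hν : ∀ᵐ w ∂ν, w ∈ Set.Ioo (0 : ℝ) 1)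
    (hlog : ∫⁻ w, ENNReal.ofReal |Real.log w| ∂ν = ∞) :
    Tendsto (potential ν bump) atTop (𝓝 0) := by
  have hfin := potential_bump_ne_top hν hlog
  set ψ : ℝ → ℝ := fun x => (potential ν bump x).toReal with hψ
  have hψm : Measurable ψ := (measurable_potential measurable_bump).ennreal_toReal
  have hψ0 : ∀ x, 0 ≤ ψ x := fun x => ENNReal.toReal_nonneg
  set B : ℝ := ((ν (Set.Iic (1 / 2 : ℝ)))⁻¹).toReal with hB
  have hψB : ∀ x, ψ x ≤ B := fun x => ENNReal.toReal_mono (ENNReal.inv_ne_top.2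
      (measure_Iic_pos hν hlog (x := 1 / 2) (by norm_num)).ne') (potential_bump_le hν hlog x)
  have hren : ∀ x, ψ x = (bump x).toReal + ∫ w, ψ (x * w) ∂ν := by
    intro x
    have h := potential_eq_add_avg (ν := ν) measurable_bump x
    rw [hψ]
    simp only
    rw [h, ENNReal.toReal_add (show bump x ≠ ∞ from ENNReal.ofReal_ne_top) (ne_top_of_le_ne_top (hfin x)
      (h ▸ le_add_self)), integral_toReal]
    · rfl
    · exact ((measurable_potential measurable_bump).comp (measurable_const_mul x)).aemeasurable
    · exact ae_of_all _ fun w => (hfin _).lt_top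
  have hbdd : IsBoundedUnder (· ≤ ·) atTop ψ := isBoundedUnder_of ⟨B, hψB⟩
  have hbdd' : IsBoundedUnder (· ≥ ·) atTop ψ := isBoundedUnder_of ⟨0, hψ0⟩
  set η : ℝ := limsup ψ atTop with hη
  have hup : ∀ ε > 0, ∀ᶠ x in atTop, ψ x < η + ε := fun ε hε =>
    eventually_lt_of_limsup_lt (by linarith) hbdd
  suffices hη0 : η ≤ 0 by
    have h1 : Tendsto ψ atTop (𝓝 0) := by
      rw [Metric.tendsto_nhds]
      intro ε hε
      filter_upwards [hup ε hε] with x hx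
      rw [Real.dist_0_eq_abs, abs_of_nonneg (hψ0 x)]
      linarith
    have h2 := (ENNReal.continuous_ofReal.tendsto 0).comp h1
    rw [ENNReal.ofReal_zero] at h2
    exact h2.congr fun x => ENNReal.ofReal_toReal (hfin x)
  by_contra! hη0
  obtain ⟨r, hr0, hr1, hrpos⟩ := exists_measure_Icc_pos hν hlog
  let S := {x : ℕ → ℝ // (∀ n, 0 < x n) ∧ Tendsto x atTop atTop ∧
    ∀ ε > 0, ∀ᶠ n in atTop, η - ε < ψ (x n)}
  have hstart : Nonempty S := by
    have hfr : ∀ n : ℕ, ∃ x : ℝ, (n : ℝ) + 1 ≤ x ∧ η - 1 / ((n : ℝ) + 1) < ψ x := by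
      intro n
      have h1 : ∃ᶠ x in atTop, η - 1 / ((n : ℝ) + 1) < ψ x := by
        refine frequently_lt_of_lt_limsup hbdd'.isCoboundedUnder_le ?_
        have : 0 < 1 / ((n : ℝ) + 1) := by positivity
        linarith
      exact (h1.and_eventually (eventually_ge_atTop ((n : ℝ) + 1))).exists.imp fun x hx => hx.symm
    choose x hx1 hx2 using hfr
    refine ⟨⟨x, fun n => lt_of_lt_of_le (by positivity) (hx1 n), ?_, fun ε hε => ?_⟩⟩
    · exact tendsto_atTop_mono hx1
        (tendsto_atTop_add_const_right _ _ tendsto_natCast_atTop_atTop)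
    · filter_upwards [(tendsto_one_div_add_atTop_nhds_zero_nat (𝕜 := ℝ)).eventually
        (gt_mem_nhds hε)] with n hn
      linarith [hx2 n]
  have hstep : ∀ x : S, ∃ y : S, ∀ n, r * x.1 n ≤ y.1 n ∧ y.1 n ≤ x.1 n / 2 := by
    rintro ⟨x, hx1, hx2, hx3⟩
    obtain ⟨y, hy1, hy2, hy3, hy4⟩ := exists_step_near_limsup hν hψm hψ0 hψB hren tendsto_bump hup
      hr0 hrpos hx1 hx2 hx3
    exact ⟨⟨y, hy1, hy2, hy3⟩, hy4⟩
  choose F hF using hstep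
  obtain ⟨x₀⟩ := hstart
  set m : ℕ → S := fun i => F^[i] x₀ with hm
  have hmF : ∀ i n, r * (m i).1 n ≤ (m (i + 1)).1 n ∧ (m (i + 1)).1 n ≤ (m i).1 n / 2 := by
    intro i n
    have : m (i + 1) = F (m i) := Function.iterate_succ_apply' F i x₀
    rw [this]
    exact hF (m i) n
  have hlow : ∀ i n, r ^ i * (m 0).1 n ≤ (m i).1 n := by
    intro i n
    induction i with
    | zero => simp
    | succ i ih =>
      rw [pow_succ']
      nlinarith [(hmF i n).1]
  have hbound : ∀ N : ℕ, ENNReal.ofReal (η / 2) *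
      ∑ i ∈ Finset.range N, ν (Set.Iic (r ^ (i + 1))) ≤ 1 := by
    intro N
    have hev : ∀ᶠ n in atTop, ∀ i ∈ Finset.range N, η - η / 2 < ψ ((m i).1 n) :=
      (Finset.eventually_all _).2 fun i _ => (m i).2.2.2 (η / 2) (by linarith)
    obtain ⟨n, hn⟩ := hev.exists
    have hx := (m 0).2.1 n
    refine le_trans ?_ (sum_mul_potential_bump_le_one hν (s := fun i => (m i).1 n / (m 0).1 n)
      (by rw [div_self hx.ne']) (fun i => div_pos ((m i).2.1 n) hx)
      (fun i => by rw [div_right_comm]; gcongr; exact (hmF i n).2) N ((m 0).1 n))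
    rw [Finset.mul_sum]
    refine Finset.sum_le_sum fun i hi => ?_
    rw [mul_comm]
    gcongr
    · rw [le_div_iff₀ hx]; exact hlow (i + 1) n
    · rw [div_mul_cancel₀ _ hx.ne']
      refine ENNReal.ofReal_le_of_le_toReal ?_
      have := hn i hi
      simp only [hψ] at this
      linarith
  have htop : ENNReal.ofReal (η / 2) * ∑' i : ℕ, ν (Set.Iic (r ^ (i + 1))) ≤ 1 := by
    rw [← ENNReal.tsum_mul_left]
    refine ENNReal.tsum_le_of_sum_range_le fun N => ?_
    rw [← Finset.mul_sum]
    exact hbound N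
  rw [tsum_measure_Iic_pow hν hlog hr0 hr1, ENNReal.mul_top] at htop
  · simp at htop
  · simpa using hη0

/-- A Poisson weight is dominated by the bump. -/
lemma pow_mul_exp_neg_le_bump {k : ℕ} (hk : 1 ≤ k) {x : ℝ} (hx : 0 ≤ x) :
    ENNReal.ofReal (x ^ k * Real.exp (-x)) ≤ ENNReal.ofReal (2 ^ k * k.factorial) * bump x := by
  unfold bump
  rw [← ENNReal.ofReal_mul (by positivity)]
  apply ENNReal.ofReal_le_ofReal
  have h1 : (x / 2) ^ k / k.factorial ≤ Real.exp (x / 2) - 1 := by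
    have h2 := Real.sum_le_exp_of_nonneg (x := x / 2) (by positivity) (k + 1)
    have h3 : ∑ i ∈ ({0, k} : Finset ℕ), (x / 2) ^ i / (i.factorial : ℝ)
        ≤ ∑ i ∈ Finset.range (k + 1), (x / 2) ^ i / (i.factorial : ℝ) := by
      refine Finset.sum_le_sum_of_subset_of_nonneg (fun i hi => ?_) fun i _ _ => by positivity
      simp only [Finset.mem_insert, Finset.mem_singleton] at hi
      simp only [Finset.mem_range]
      omega
    rw [Finset.sum_pair (by omega)] at h3
    simp only [pow_zero, Nat.factorial_zero, Nat.cast_one, div_one] at h3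
    linarith
  have h4 : Real.exp (-(x / 2)) - Real.exp (-x) = (Real.exp (x / 2) - 1) * Real.exp (-x) := by
    rw [sub_mul, ← Real.exp_add, one_mul]
    ring_nf
  rw [h4, ← mul_assoc]
  gcongr
  rw [div_pow, div_div, div_le_iff₀ (by positivity)] at h1
  linarith

/-! ### From tails to moments -/

lemma integrable_pow_of_mem_Ioo {Ω : Type*} [MeasurableSpace Ω] {μ : Measure Ω}
    [IsFiniteMeasure μ] {X : Ω → ℝ} (hXm : Measurable X) (hX : ∀ᵐ ω ∂μ, X ω ∈ Set.Ioo (0 : ℝ) 1)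
    (n : ℕ) : Integrable (fun ω => X ω ^ n) μ := by
  refine Integrable.of_bound (hXm.pow_const n).aestronglyMeasurable 1 ?_
  filter_upwards [hX] with ω hω
  rw [Real.norm_of_nonneg (pow_nonneg hω.1.le n)]
  exact pow_le_one₀ hω.1.le hω.2.le

lemma integral_pow_pos_of_mem_Ioo {Ω : Type*} [MeasurableSpace Ω] {μ : Measure Ω}
    [IsProbabilityMeasure μ] {X : Ω → ℝ} (hXm : Measurable X)
    (hX : ∀ᵐ ω ∂μ, X ω ∈ Set.Ioo (0 : ℝ) 1) (n : ℕ) : 0 < ∫ ω, X ω ^ n ∂μ := by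
  rw [integral_pos_iff_support_of_nonneg_ae (hX.mono fun ω hω => pow_nonneg hω.1.le n)
    (integrable_pow_of_mem_Ioo hXm hX n)]
  have : Function.support (fun ω => X ω ^ n) =ᵐ[μ] Set.univ := by
    filter_upwards [hX] with ω hω
    exact propext ⟨fun _ => trivial, fun _ => (pow_pos hω.1 n).ne'⟩
  rw [measure_congr this]
  simp

lemma lintegral_pow_eq {Ω : Type*} [MeasurableSpace Ω] {μ : Measure Ω} {X : Ω → ℝ}
    (hXm : AEMeasurable X μ) (hX0 : 0 ≤ᵐ[μ] X) {n : ℕ} (hn : n ≠ 0) :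
    ∫⁻ ω, ENNReal.ofReal (X ω ^ n) ∂μ
      = ∫⁻ t in Set.Ioi 0, μ {ω | t ≤ X ω} * ENNReal.ofReal (n * t ^ (n - 1)) := by
  rw [← lintegral_comp_eq_lintegral_meas_le_mul μ hX0 hXm (g := fun t => n * t ^ (n - 1))]
  · refine lintegral_congr fun ω => ?_
    rw [intervalIntegral.integral_const_mul, integral_pow]
    obtain ⟨m, rfl⟩ := Nat.exists_eq_succ_of_ne_zero hn
    congr 1
    simp
    field_simp
  · intro t ht
    exact Continuous.intervalIntegrable (by fun_prop) _ _
  · refine (ae_restrict_iff' measurableSet_Ioi).2 (ae_of_all _ fun t ht => ?_)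
    have : (0 : ℝ) < t := ht
    positivity

/-- A comparison of upper tails near `1` gives a comparison of high moments, up to a term of lower
exponential order. -/
lemma integral_pow_le {Ω : Type*} [MeasurableSpace Ω] {μ : Measure Ω} [IsProbabilityMeasure μ]
    {X Y : Ω → ℝ} (hXm : Measurable X) (hYm : Measurable Y)
    (hX : ∀ᵐ ω ∂μ, X ω ∈ Set.Ioo (0 : ℝ) 1) (hY : ∀ᵐ ω ∂μ, Y ω ∈ Set.Ioo (0 : ℝ) 1)
    {κ ρ : ℝ} (hκ : 0 ≤ κ) (hρ : 0 < ρ)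
    (h : ∀ t, ρ ≤ t → t < 1 → μ.real {ω | t ≤ X ω} ≤ κ * μ.real {ω | t ≤ Y ω}) {n : ℕ}
    (hn : n ≠ 0) :
    ∫ ω, X ω ^ n ∂μ ≤ κ * ∫ ω, Y ω ^ n ∂μ + ρ ^ n := by
  have conv : ∀ Z : Ω → ℝ, Measurable Z → (∀ᵐ ω ∂μ, Z ω ∈ Set.Ioo (0 : ℝ) 1) →
      ∫ ω, Z ω ^ n ∂μ = (∫⁻ ω, ENNReal.ofReal (Z ω ^ n) ∂μ).toReal ∧
        ∫⁻ ω, ENNReal.ofReal (Z ω ^ n) ∂μ ≠ ∞ := by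
    intro Z hZm hZ
    refine ⟨integral_eq_lintegral_of_nonneg_ae
      (hZ.mono fun ω hω => pow_nonneg hω.1.le n) (hZm.pow_const n).aestronglyMeasurable, ?_⟩
    refine ne_top_of_le_ne_top ENNReal.one_ne_top ?_
    refine (lintegral_mono_ae (g := fun _ => 1) (hZ.mono fun ω hω => ?_)).trans (by simp)
    exact ENNReal.ofReal_le_one.2 (pow_le_one₀ hω.1.le hω.2.le)
  have key : ∫⁻ ω, ENNReal.ofReal (X ω ^ n) ∂μ
      ≤ ENNReal.ofReal κ * ∫⁻ ω, ENNReal.ofReal (Y ω ^ n) ∂μ + ENNReal.ofReal (ρ ^ n) := by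
    rw [lintegral_pow_eq hXm.aemeasurable (hX.mono fun ω hω => hω.1.le) hn,
      lintegral_pow_eq hYm.aemeasurable (hY.mono fun ω hω => hω.1.le) hn,
      ← lintegral_const_mul' _ _ ENNReal.ofReal_ne_top]
    have hmeas : Measurable ((Set.Ioc 0 ρ).indicator
        fun t : ℝ => ENNReal.ofReal (n * t ^ (n - 1))) :=
      Measurable.indicator (by fun_prop) measurableSet_Ioc
    have hρn : ∫⁻ t in Set.Ioi 0, (Set.Ioc 0 ρ).indicator
        (fun t : ℝ => ENNReal.ofReal (n * t ^ (n - 1))) t = ENNReal.ofReal (ρ ^ n) := by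
      rw [lintegral_indicator measurableSet_Ioc, Measure.restrict_restrict measurableSet_Ioc,
        Set.inter_eq_left.2 Set.Ioc_subset_Ioi_self, ← ofReal_integral_eq_lintegral_ofReal]
      · rw [← intervalIntegral.integral_of_le hρ.le, intervalIntegral.integral_const_mul,
          integral_pow]
        obtain ⟨m, rfl⟩ := Nat.exists_eq_succ_of_ne_zero hn
        congr 1
        simp
        field_simp
      · exact (intervalIntegrable_iff_integrableOn_Ioc_of_le hρ.le).1
          (Continuous.intervalIntegrable (by fun_prop) _ _)
      · refine (ae_restrict_iff' measurableSet_Ioc).2 (ae_of_all _ fun t ht => ?_)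
        have : (0 : ℝ) < t := ht.1
        simp only [Pi.zero_apply]
        positivity
    rw [← hρn, ← lintegral_add_right _ hmeas]
    refine setLIntegral_mono' measurableSet_Ioi fun t ht => ?_
    rcases lt_or_ge t ρ with htρ | htρ
    · rw [Set.indicator_of_mem (show t ∈ Set.Ioc 0 ρ from ⟨ht, htρ.le⟩)]
      refine le_add_left ?_
      exact mul_le_of_le_one_left' prob_le_one
    · refine le_add_right ?_
      rw [← mul_assoc]
      gcongr
      rcases lt_or_ge t 1 with ht1 | ht1
      · have h1 := ENNReal.ofReal_le_ofReal (h t htρ ht1)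
        rwa [ENNReal.ofReal_mul hκ, ofReal_measureReal, ofReal_measureReal] at h1
      · have : μ {ω | t ≤ X ω} = 0 := by
          rw [measure_eq_zero_iff_ae_notMem]
          filter_upwards [hX] with ω hω
          simp only [not_le]
          linarith [hω.2]
        rw [this]
        exact zero_le
  obtain ⟨hX1, -⟩ := conv X hXm hX
  obtain ⟨hY1, hY2⟩ := conv Y hYm hY
  rw [hX1, hY1]
  have h1 := ENNReal.toReal_mono (ENNReal.add_ne_top.2
    ⟨ENNReal.mul_ne_top ENNReal.ofReal_ne_top hY2, ENNReal.ofReal_ne_top⟩) key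
  rwa [ENNReal.toReal_add (ENNReal.mul_ne_top ENNReal.ofReal_ne_top hY2) ENNReal.ofReal_ne_top,
    ENNReal.toReal_mul, ENNReal.toReal_ofReal hκ, ENNReal.toReal_ofReal (by positivity)] at h1

/-- High moments of a variable with mass arbitrarily close to `1` decay subexponentially. -/
lemma tendsto_pow_div_integral_pow {Ω : Type*} [MeasurableSpace Ω] {μ : Measure Ω}
    [IsProbabilityMeasure μ] {X : Ω → ℝ} (hXm : Measurable X)
    (hX : ∀ᵐ ω ∂μ, X ω ∈ Set.Ioo (0 : ℝ) 1) (hpos : ∀ t < 1, 0 < μ {ω | t ≤ X ω}) {ρ : ℝ}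
    (hρ0 : 0 < ρ) (hρ1 : ρ < 1) :
    Tendsto (fun n : ℕ => ρ ^ n / ∫ ω, X ω ^ n ∂μ) atTop (𝓝 0) := by
  set r := (ρ + 1) / 2 with hr
  have hrρ : ρ < r := by rw [hr]; linarith
  have hr0 : 0 < r := by linarith
  set p := μ.real {ω | r ≤ X ω} with hp
  have hp0 : 0 < p := ENNReal.toReal_pos (hpos r (by rw [hr]; linarith)).ne' (measure_ne_top _ _)
  have hlow : ∀ n : ℕ, r ^ n * p ≤ ∫ ω, X ω ^ n ∂μ := by
    intro n
    have hint := integrable_pow_of_mem_Ioo hXm hX n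
    have hms : MeasurableSet {ω | r ≤ X ω} := measurableSet_le measurable_const hXm
    have h1 : ∫ ω, {ω | r ≤ X ω}.indicator (fun _ => r ^ n) ω ∂μ = r ^ n * p := by
      rw [integral_indicator_const _ hms, smul_eq_mul, mul_comm]
    rw [← h1]
    refine integral_mono_ae ((integrable_const _).indicator hms) hint ?_
    filter_upwards [hX] with ω hω
    by_cases h : r ≤ X ω
    · rw [Set.indicator_of_mem (by exact h)]
      exact pow_le_pow_left₀ hr0.le h n
    · rw [Set.indicator_of_notMem (by exact h)]
      exact pow_nonneg hω.1.le n
  have h0 : Tendsto (fun n : ℕ => (ρ / r) ^ n * p⁻¹) atTop (𝓝 (0 * p⁻¹)) :=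
    (tendsto_pow_atTop_nhds_zero_of_lt_one (by positivity)
      ((div_lt_one hr0).2 hrρ)).mul_const _
  rw [zero_mul] at h0
  refine squeeze_zero (fun n => ?_) (fun n => ?_) h0
  · exact div_nonneg (by positivity) (le_trans (by positivity) (hlow n))
  · rw [div_pow, ← div_eq_mul_inv, div_div]
    exact div_le_div_of_nonneg_left (by positivity) (by positivity) (hlow n)

/-- An Abelian theorem: the ratio of the tails of `1 - W` and `W` at `0` determines the
ratio of the high moments of `W` and `1 - W`. -/
theorem tendsto_moment_ratio_of_tendsto_tail_ratio {Ω : Type*} [MeasurableSpace Ω] {μ : Measure Ω}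
    [IsProbabilityMeasure μ] {W : Ω → ℝ} (hWm : Measurable W)
    (hW : ∀ᵐ ω ∂μ, W ω ∈ Set.Ioo (0 : ℝ) 1) (hpos : ∀ x > 0, 0 < μ {ω | W ω ≤ x}) {c : ℝ}
    (hc : 0 < c)
    (h : Tendsto (fun x : ℝ => μ.real {ω | 1 - W ω ≤ x} / μ.real {ω | W ω ≤ x}) (𝓝[>] 0) (𝓝 c)) :
    Tendsto (fun n : ℕ => (∫ ω, W ω ^ n ∂μ) / ∫ ω, (1 - W ω) ^ n ∂μ) atTop (𝓝 c) := by
  have hposr : ∀ x > 0, 0 < μ.real {ω | W ω ≤ x} := fun x hx =>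
    ENNReal.toReal_pos (hpos x hx).ne' (measure_ne_top _ _)
  have hVm : Measurable fun ω => 1 - W ω := by fun_prop
  have hV : ∀ᵐ ω ∂μ, 1 - W ω ∈ Set.Ioo (0 : ℝ) 1 :=
    hW.mono fun ω hω => ⟨by linarith [hω.2], by linarith [hω.1]⟩
  have htail1 : ∀ t, {ω | t ≤ W ω} = {ω | 1 - W ω ≤ 1 - t} := fun t => by
    ext ω; simp only [Set.mem_ofPred_eq]; constructor <;> intro h <;> linarith
  have htail2 : ∀ t, {ω | t ≤ 1 - W ω} = {ω | W ω ≤ 1 - t} := fun t => by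
    ext ω; simp only [Set.mem_ofPred_eq]; constructor <;> intro h <;> linarith
  have hsmall := fun ρ (hρ0 : 0 < ρ) (hρ1 : ρ < 1) => tendsto_pow_div_integral_pow hVm hV
    (fun t ht => by rw [htail2]; exact hpos _ (by linarith)) hρ0 hρ1
  have hbpos := integral_pow_pos_of_mem_Ioo hVm hV
  -- an interval on which the ratio of the tails is close to its limit
  have hnear : ∀ a b : ℝ, a < c → c < b → ∃ ρ : ℝ, 0 < ρ ∧ ρ < 1 ∧ ∀ t, ρ ≤ t → t < 1 →
      a * μ.real {ω | W ω ≤ 1 - t} ≤ μ.real {ω | 1 - W ω ≤ 1 - t} ∧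
      μ.real {ω | 1 - W ω ≤ 1 - t} ≤ b * μ.real {ω | W ω ≤ 1 - t} := by
    intro a b ha hb
    have h1 := h.eventually (Ioo_mem_nhds ha hb)
    rw [eventually_nhdsWithin_iff, Metric.eventually_nhds_iff] at h1
    obtain ⟨d, hd, h1⟩ := h1
    refine ⟨1 - min d 1 / 2, ?_, ?_, fun t ht ht1 => ?_⟩
    · linarith [min_le_right d 1]
    · linarith [lt_min hd one_pos]
    · have h2 := h1 (y := 1 - t) (by
        rw [Real.dist_0_eq_abs, abs_of_pos (by linarith)]
        linarith [min_le_left d 1, lt_min hd one_pos]) (by simp only [Set.mem_Ioi]; linarith)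
      have h3 := hposr (1 - t) (by linarith)
      rw [lt_div_iff₀ h3, div_lt_iff₀ h3] at h2
      exact ⟨h2.1.le, h2.2.le⟩
  refine tendsto_order.2 ⟨fun a ha => ?_, fun b hb => ?_⟩
  · rcases le_or_gt a 0 with ha0 | ha0
    · exact Eventually.of_forall fun n =>
        ha0.trans_lt (div_pos (integral_pow_pos_of_mem_Ioo hWm hW n) (hbpos n))
    obtain ⟨a', ha'1, ha'2⟩ := exists_between ha
    have ha'0 : 0 < a' := ha0.trans ha'1
    obtain ⟨ρ, hρ0, hρ1, hρ⟩ := hnear a' (c + 1) ha'2 (by linarith)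
    have hle := fun n (hn : n ≠ 0) => integral_pow_le hVm hWm hV hW (κ := 1 / a') (ρ := ρ)
      (by positivity) hρ0 (fun t ht ht1 => by
        rw [htail1, htail2, one_div, ← div_eq_inv_mul, le_div_iff₀ ha'0, mul_comm]
        exact (hρ t ht ht1).1) (n := n) hn
    have hsm := (hsmall ρ hρ0 hρ1).eventually
      (gt_mem_nhds (show (0 : ℝ) < 1 - a / a' by
        rw [sub_pos, div_lt_one ha'0]; exact ha'1))
    filter_upwards [hsm, eventually_ne_atTop 0] with n hn hn0
    have h1 := hle n hn0
    have hb := hbpos n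
    rw [div_lt_iff₀ hb] at hn
    rw [lt_div_iff₀ hb]
    have h2 : (a / a') * ∫ ω, (1 - W ω) ^ n ∂μ < 1 / a' * ∫ ω, W ω ^ n ∂μ := by nlinarith
    rw [div_mul_eq_mul_div, div_mul_eq_mul_div, one_mul] at h2
    exact (div_lt_div_iff_of_pos_right ha'0).1 h2
  · obtain ⟨b', hb'1, hb'2⟩ := exists_between hb
    obtain ⟨ρ, hρ0, hρ1, hρ⟩ := hnear 0 b' hc hb'1
    have hle := fun n (hn : n ≠ 0) => integral_pow_le hWm hVm hW hV (κ := b') (ρ := ρ)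
      (by linarith) hρ0 (fun t ht ht1 => by
        rw [htail1, htail2]
        exact (hρ t ht ht1).2) (n := n) hn
    have hsm := (hsmall ρ hρ0 hρ1).eventually (gt_mem_nhds (sub_pos.2 hb'2))
    filter_upwards [hsm, eventually_ne_atTop 0] with n hn hn0
    have h1 := hle n hn0
    have hb := hbpos n
    rw [div_lt_iff₀ hb] at hn
    rw [div_lt_iff₀ hb]
    nlinarith

/-! ### The chain of remaining balls -/

/-- The set of those among the first `n` balls (numbered from `0`) that fall into none of the boxes
`1, …, j`. -/
noncomputable def remaining (w u : ℕ → ℝ) (n j : ℕ) : Finset ℕ :=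
  {i ∈ Finset.range n | u i ≤ T w j}

/-- The number of boxes among `1, …, j` that are empty although balls remain after them. -/
noncomputable def loops (w u : ℕ → ℝ) (n j : ℕ) : ℕ :=
  (Finset.filter (fun i => (remaining w u n i).Nonempty ∧
    remaining w u n (i + 1) = remaining w u n i) (Finset.range j)).card

variable {w u : ℕ → ℝ} {n : ℕ}

lemma T_zero (w : ℕ → ℝ) : T w 0 = 1 := by simp [T]

lemma T_succ (w : ℕ → ℝ) (j : ℕ) : T w (j + 1) = T w j * w j := Finset.prod_range_succ _ _

lemma T_pos (hw : ∀ i, w i ∈ Set.Ioo (0 : ℝ) 1) (j : ℕ) : 0 < T w j :=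
  Finset.prod_pos fun i _ => (hw i).1

lemma T_antitone (hw : ∀ i, w i ∈ Set.Ioo (0 : ℝ) 1) : Antitone (T w) :=
  antitone_nat_of_succ_le fun j => by
    rw [T_succ]
    exact mul_le_of_le_one_right (T_pos hw j).le (hw j).2.le

lemma T_le_one (hw : ∀ i, w i ∈ Set.Ioo (0 : ℝ) 1) (j : ℕ) : T w j ≤ 1 :=
  (T_antitone hw (Nat.zero_le j)).trans_eq (T_zero w)

lemma mem_remaining {j i : ℕ} : i ∈ remaining w u n j ↔ i < n ∧ u i ≤ T w j := by
  simp [remaining]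

lemma remaining_subset_range (w u : ℕ → ℝ) (n j : ℕ) : remaining w u n j ⊆ Finset.range n :=
  Finset.filter_subset _ _

lemma remaining_antitone (hw : ∀ i, w i ∈ Set.Ioo (0 : ℝ) 1) : Antitone (remaining w u n) := by
  intro i j hij k hk
  rw [mem_remaining] at hk ⊢
  exact ⟨hk.1, hk.2.trans (T_antitone hw hij)⟩

lemma remaining_zero (hu : ∀ i, u i ≤ 1) : remaining w u n 0 = Finset.range n := by
  ext i
  rw [mem_remaining, T_zero, Finset.mem_range]
  exact ⟨fun h => h.1, fun h => ⟨h, hu i⟩⟩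

lemma loops_succ (w u : ℕ → ℝ) (n j : ℕ) : loops w u n (j + 1) = loops w u n j +
    if (remaining w u n j).Nonempty ∧ remaining w u n (j + 1) = remaining w u n j
      then 1 else 0 := by
  unfold loops
  rw [Finset.range_add_one, Finset.filter_insert]
  split_ifs with h
  · rw [Finset.card_insert_of_notMem (by simp)]
  · rfl

lemma succ_mem_occupied_iff (hw : ∀ i, w i ∈ Set.Ioo (0 : ℝ) 1) (j : ℕ) :
    j + 1 ∈ occupied w u n ↔ remaining w u n (j + 1) ≠ remaining w u n j := by
  constructor
  · rintro ⟨-, i, hi, hiu⟩ heq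
    simp only [box, Set.mem_Ioc, Nat.add_sub_cancel] at hiu
    have h1 : i ∈ remaining w u n j := mem_remaining.2 ⟨hi, hiu.2⟩
    rw [← heq, mem_remaining] at h1
    exact absurd h1.2 (not_le.2 hiu.1)
  · intro hne
    obtain ⟨i, hi, hi'⟩ := Finset.exists_of_ssubset
      ((remaining_antitone hw (Nat.le_succ j)).lt_of_ne hne)
    rw [mem_remaining] at hi hi'
    refine ⟨Nat.le_add_left 1 j, i, hi.1, ?_⟩
    simp only [box, Set.mem_Ioc, Nat.add_sub_cancel]
    exact ⟨lt_of_not_ge fun h => hi' ⟨hi.1, h⟩, hi.2⟩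

/-- Once no ball remains, the empty boxes within the occupancy range have all been counted. -/
lemma numEmpty_eq_loops (hw : ∀ i, w i ∈ Set.Ioo (0 : ℝ) 1) {J : ℕ}
    (hJ : remaining w u n J = ∅) : numEmpty w u n = loops w u n J := by
  classical
  have hempty : ∀ j, J ≤ j → remaining w u n j = ∅ := fun j hj =>
    Finset.subset_empty.1 (hJ ▸ remaining_antitone hw hj)
  set O := Finset.filter (fun i => remaining w u n (i + 1) ≠ remaining w u n i)
    (Finset.range J) with hO
  set D := Finset.filter (fun i => (remaining w u n i).Nonempty) (Finset.range J) with hD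
  have hocc : occupied w u n = ↑(O.image Nat.succ) := by
    ext k
    cases k with
    | zero => simp [occupied]
    | succ k =>
      rw [succ_mem_occupied_iff hw, Finset.mem_coe, Finset.mem_image]
      constructor
      · intro h
        refine ⟨k, Finset.mem_filter.2 ⟨Finset.mem_range.2 ?_, h⟩, rfl⟩
        by_contra! hk
        exact h (by rw [hempty k hk, hempty (k + 1) (by omega)])
      · rintro ⟨k', hk', hkk⟩
        obtain rfl : k' = k := by simpa using hkk
        exact (Finset.mem_filter.1 hk').2
  have hnum : numOccupied w u n = O.card := by
    rw [numOccupied, hocc, Set.ncard_coe_finset, Finset.card_image_of_injective _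
      Nat.succ_injective]
  have hbdd : BddAbove (occupied w u n) := by rw [hocc]; exact Finset.bddAbove _
  have hDrange : D = Finset.range (lastOccupied w u n) := by
    ext i
    rw [hD, Finset.mem_filter, Finset.mem_range, Finset.mem_range]
    constructor
    · rintro ⟨hiJ, hi⟩
      by_contra! hcon
      have hconst : ∀ j, i ≤ j → remaining w u n j = remaining w u n i := by
        intro j hj
        induction j, hj using Nat.le_induction with
        | base => rfl
        | succ j hj ih =>
          by_contra hne
          have h1 := (succ_mem_occupied_iff (u := u) (n := n) hw j).2 (by rwa [ih])
          have h2 : j + 1 ≤ lastOccupied w u n := le_csSup hbdd h1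
          omega
      rw [← hconst J hiJ.le, hJ] at hi
      exact Finset.not_nonempty_empty hi
    · intro hi
      have hne : (occupied w u n).Nonempty := by
        by_contra hcon
        rw [Set.not_nonempty_iff_eq_empty] at hcon
        rw [lastOccupied, hcon] at hi
        simp at hi
      have hmem : lastOccupied w u n ∈ occupied w u n := Nat.sSup_mem hne hbdd
      obtain ⟨m, hm⟩ : ∃ m, lastOccupied w u n = m + 1 := ⟨_, (Nat.succ_pred_eq_of_pos
        (by omega)).symm⟩
      rw [hm, succ_mem_occupied_iff hw] at hmem
      have hmne : (remaining w u n m).Nonempty := by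
        by_contra hcon
        rw [Finset.not_nonempty_iff_eq_empty] at hcon
        refine hmem ?_
        have := remaining_antitone (u := u) (n := n) hw (Nat.le_succ m)
        rw [hcon] at this ⊢
        exact Finset.subset_empty.1 this
      have hine : (remaining w u n i).Nonempty :=
        hmne.mono (remaining_antitone hw (by omega))
      refine ⟨?_, hine⟩
      by_contra! hcon
      rw [hempty i hcon] at hine
      exact Finset.not_nonempty_empty hine
  have hOD : Finset.filter (fun i => remaining w u n (i + 1) ≠ remaining w u n i) D = O := by
    rw [hD, Finset.filter_filter, hO]
    refine Finset.filter_congr fun i _ => ⟨fun h => h.2, fun h => ⟨?_, h⟩⟩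
    by_contra hcon
    rw [Finset.not_nonempty_iff_eq_empty] at hcon
    have := remaining_antitone (u := u) (n := n) hw (Nat.le_succ i)
    rw [hcon] at this
    exact h (by rw [hcon]; exact Finset.subset_empty.1 this)
  have hcard := Finset.card_filter_add_card_filter_not (s := D)
    (fun i => remaining w u n (i + 1) = remaining w u n i)
  have hloops : loops w u n J
      = (Finset.filter (fun i => remaining w u n (i + 1) = remaining w u n i) D).card := by
    rw [loops, hD, Finset.filter_filter]
  rw [hOD, hDrange, Finset.card_range, ← hDrange, ← hloops] at hcard
  rw [numEmpty, hnum]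
  omega

/-! ### Measurability -/

lemma measurable_T (j : ℕ) : Measurable fun w : ℕ → ℝ => T w j := by
  unfold T
  fun_prop

lemma measurableSet_remaining_eq (n j : ℕ) (A : Finset ℕ) :
    MeasurableSet {p : (ℕ → ℝ) × (ℕ → ℝ) | remaining p.1 p.2 n j = A} := by
  have : {p : (ℕ → ℝ) × (ℕ → ℝ) | remaining p.1 p.2 n j = A}
      = ⋂ i : ℕ, {p : (ℕ → ℝ) × (ℕ → ℝ) | (i < n ∧ p.2 i ≤ T p.1 j) ↔ i ∈ A} := by
    ext p
    simp only [Set.mem_ofPred_eq, Set.mem_iInter, Finset.ext_iff, mem_remaining]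
  rw [this]
  refine MeasurableSet.iInter fun i => ?_
  have h1 : MeasurableSet {p : (ℕ → ℝ) × (ℕ → ℝ) | p.2 i ≤ T p.1 j} :=
    measurableSet_le ((measurable_pi_apply i).comp measurable_snd)
      ((measurable_T j).comp measurable_fst)
  exact ((MeasurableSet.const (i < n)).inter h1).iff (MeasurableSet.const (i ∈ A))

lemma measurable_loops (n j : ℕ) :
    Measurable fun p : (ℕ → ℝ) × (ℕ → ℝ) => loops p.1 p.2 n j := by
  induction j with
  | zero => simp [loops]
  | succ j ih =>
    simp only [loops_succ]
    refine ih.add (Measurable.ite ?_ measurable_const measurable_const)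
    have : {p : (ℕ → ℝ) × (ℕ → ℝ) | (remaining p.1 p.2 n j).Nonempty ∧
        remaining p.1 p.2 n (j + 1) = remaining p.1 p.2 n j}
        = ⋃ A ∈ {A : Finset ℕ | A.Nonempty}, ({p | remaining p.1 p.2 n j = A} ∩
          {p | remaining p.1 p.2 n (j + 1) = A}) := by
      ext p
      simp only [Set.mem_ofPred_eq, Set.mem_iUnion, Set.mem_inter_iff, exists_prop]
      exact ⟨fun h => ⟨_, h.1, rfl, h.2⟩, fun ⟨A, hA, h1, h2⟩ => ⟨h1 ▸ hA, h2.trans h1.symm⟩⟩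
    rw [this]
    exact MeasurableSet.biUnion (Set.to_countable _) fun A _ =>
      (measurableSet_remaining_eq n j A).inter (measurableSet_remaining_eq n (j + 1) A)

/-! ### One step of the chain for given box sizes -/

variable {Ω : Type*} [MeasurableSpace Ω] {P : Measure Ω}

lemma measure_uniform_Ioc {V : Ω → ℝ} (hVm : Measurable V)
    (hV : pdf.IsUniform V (Set.Icc (0 : ℝ) 1) P volume) {a b : ℝ} (ha : 0 ≤ a) (hb : b ≤ 1) :
    P (V ⁻¹' Set.Ioc a b) = ENNReal.ofReal (b - a) := by
  rw [← Measure.map_apply hVm measurableSet_Ioc, hV, cond_apply measurableSet_Icc,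
    Set.inter_eq_right.2 (Set.Ioc_subset_Icc_self.trans (Set.Icc_subset_Icc ha hb))]
  simp

lemma ae_uniform_mem_Ioc [IsProbabilityMeasure P] {V : Ω → ℝ} (hVm : Measurable V)
    (hV : pdf.IsUniform V (Set.Icc (0 : ℝ) 1) P volume) : ∀ᵐ ω ∂P, V ω ∈ Set.Ioc (0 : ℝ) 1 := by
  have h := measure_uniform_Ioc hVm hV (le_refl 0) (le_refl 1)
  rw [sub_zero, ENNReal.ofReal_one] at h
  exact (prob_compl_eq_zero_iff (hVm measurableSet_Ioc)).2 h

lemma measure_uniform_Iic [IsProbabilityMeasure P] {V : Ω → ℝ} (hVm : Measurable V)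
    (hV : pdf.IsUniform V (Set.Icc (0 : ℝ) 1) P volume) {b : ℝ} (hb : b ≤ 1) :
    P (V ⁻¹' Set.Iic b) = ENNReal.ofReal b := by
  have h := measure_uniform_Ioc hVm hV (le_refl 0) hb
  rw [sub_zero] at h
  rw [← h]
  refine measure_congr ?_
  filter_upwards [ae_uniform_mem_Ioc hVm hV] with ω hω
  exact propext ⟨fun h => ⟨hω.1, h⟩, fun h => h.2⟩

lemma measure_uniform_Ioi [IsProbabilityMeasure P] {V : Ω → ℝ} (hVm : Measurable V)
    (hV : pdf.IsUniform V (Set.Icc (0 : ℝ) 1) P volume) {b : ℝ} (hb : 0 ≤ b) :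
    P (V ⁻¹' Set.Ioi b) = ENNReal.ofReal (1 - b) := by
  rw [← measure_uniform_Ioc hVm hV hb le_rfl]
  refine measure_congr ?_
  filter_upwards [ae_uniform_mem_Ioc hVm hV] with ω hω
  exact propext ⟨fun h => ⟨h, hω.2⟩, fun h => h.1⟩

/-- The positions of the balls in `B`; all other balls are moved to `0`. -/
def keep (B : Finset ℕ) (u : ℕ → ℝ) (i : ℕ) : ℝ := if i ∈ B then u i else 0

lemma remaining_keep {w u : ℕ → ℝ} (hw : ∀ i, w i ∈ Set.Ioo (0 : ℝ) 1) {n j : ℕ} {A : Finset ℕ}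
    (hu : ∀ i ∈ A, u i ≤ T w j) {l : ℕ} (hl : l ≤ j) :
    remaining w (keep (Finset.range n \ A) u) n l = remaining w u n l := by
  ext i
  simp only [mem_remaining, and_congr_right_iff]
  intro hi
  by_cases hiA : i ∈ A
  · have h1 : u i ≤ T w l := (hu i hiA).trans (T_antitone hw hl)
    simp [keep, hiA, h1, (T_pos hw l).le]
  · simp [keep, hiA, hi]

lemma loops_keep {w u : ℕ → ℝ} (hw : ∀ i, w i ∈ Set.Ioo (0 : ℝ) 1) {n j : ℕ} {A : Finset ℕ}
    (hu : ∀ i ∈ A, u i ≤ T w j) :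
    loops w (keep (Finset.range n \ A) u) n j = loops w u n j := by
  unfold loops
  congr 1
  refine Finset.filter_congr fun i hi => ?_
  rw [Finset.mem_range] at hi
  rw [remaining_keep hw hu hi.le, remaining_keep hw hu (Nat.succ_le_of_lt hi)]

/-- The pairs of box sizes and ball positions for which `A` is the set of balls remaining after `j`
boxes and `m` empty boxes have been seen so far. -/
def stateSet (n j m : ℕ) (A : Finset ℕ) : Set ((ℕ → ℝ) × (ℕ → ℝ)) :=
  {p | loops p.1 p.2 n j = m ∧ remaining p.1 p.2 n j = A}

lemma measurableSet_stateSet (n j m : ℕ) (A : Finset ℕ) : MeasurableSet (stateSet n j m A) :=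
  ((measurable_loops n j) (measurableSet_singleton m)).inter (measurableSet_remaining_eq n j A)

/-- Given the box sizes and the state after `j` boxes, the remaining balls are independent and
uniform on `(0, T_j]`: the state is a function of the positions of the balls outside `A`, together
with the event that the balls in `A` lie below `T_j`. -/
lemma exists_measure_state_inter [IsProbabilityMeasure P] {U : ℕ → Ω → ℝ}
    (hUm : ∀ i, Measurable (U i)) (hUi : iIndepFun U P)
    (hU : ∀ i, pdf.IsUniform (U i) (Set.Icc (0 : ℝ) 1) P volume) {w : ℕ → ℝ}
    (hw : ∀ i, w i ∈ Set.Ioo (0 : ℝ) 1) (n j m : ℕ) (A : Finset ℕ) :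
    ∃ α : ℝ≥0∞, ∀ I : Set ℝ, MeasurableSet I → I ⊆ Set.Iic (T w j) →
      P {ω | (w, fun i => U i ω) ∈ stateSet n j m A ∧ ∀ i ∈ A, U i ω ∈ I}
        = α * P (U 0 ⁻¹' I) ^ A.card := by
  classical
  set B := Finset.range n \ A with hB
  refine ⟨P {ω | (w, keep B fun i => U i ω) ∈ stateSet n j m A}, fun I hI hIT => ?_⟩
  have hset : {ω | (w, fun i => U i ω) ∈ stateSet n j m A ∧ ∀ i ∈ A, U i ω ∈ I}
      = {ω | (w, keep B fun i => U i ω) ∈ stateSet n j m A} ∩ ⋂ i ∈ A, U i ⁻¹' I := by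
    ext ω
    simp only [Set.mem_ofPred_eq, Set.mem_inter_iff, Set.mem_iInter, Set.mem_preimage]
    refine and_congr_left fun h => ?_
    have hu : ∀ i ∈ A, (fun i => U i ω) i ≤ T w j := fun i hi => hIT (h i hi)
    simp only [stateSet, Set.mem_ofPred_eq]
    rw [loops_keep hw hu, remaining_keep hw hu le_rfl]
  have hind := hUi.indepFun_finset B A Finset.sdiff_disjoint hUm
  let ext' : (B → ℝ) → ℕ → ℝ := fun v i => if h : i ∈ B then v ⟨i, h⟩ else 0
  have hext : Measurable ext' := by
    refine measurable_pi_lambda _ fun i => ?_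
    by_cases h : i ∈ B
    · simp only [ext', h, dif_pos]; exact measurable_pi_apply _
    · simp only [ext', h, dif_neg, not_false_eq_true]; exact measurable_const
  have hm1 : MeasurableSet {v : B → ℝ | (w, ext' v) ∈ stateSet n j m A} :=
    (measurable_const.prodMk hext) (measurableSet_stateSet n j m A)
  have hm2 : MeasurableSet {v : A → ℝ | ∀ i, v i ∈ I} := by
    rw [show {v : A → ℝ | ∀ i, v i ∈ I} = ⋂ i, (fun v : A → ℝ => v i) ⁻¹' I by ext; simp]
    exact MeasurableSet.iInter fun i => measurable_pi_apply i hI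
  have h1 := hind.measure_inter_preimage_eq_mul _ _ hm1 hm2
  have h2 : (fun ω (i : B) => U i ω) ⁻¹' {v : B → ℝ | (w, ext' v) ∈ stateSet n j m A}
      = {ω | (w, keep B fun i => U i ω) ∈ stateSet n j m A} := by
    ext ω
    have : (ext' fun i : B => U i ω) = keep B fun i => U i ω := by
      ext i
      simp only [ext', keep]
      split_ifs <;> rfl
    simp only [Set.mem_preimage, Set.mem_ofPred_eq, this]
  have h3 : (fun ω (i : A) => U i ω) ⁻¹' {v : A → ℝ | ∀ i, v i ∈ I} = ⋂ i ∈ A, U i ⁻¹' I := by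
    ext ω; simp
  rw [h2, h3] at h1
  rw [hset, h1, hUi.measure_inter_preimage_eq_mul A (sets := fun _ => I) fun _ _ => hI]
  congr 1
  rw [← Finset.prod_const]
  refine Finset.prod_congr rfl fun i _ => ?_
  rw [← Measure.map_apply (hUm i) hI, ← Measure.map_apply (hUm 0) hI, hU i, hU 0]

/-- All remaining balls miss the next box with conditional probability `w_j ^ |A|`. -/
lemma measure_state_stay [IsProbabilityMeasure P] {U : ℕ → Ω → ℝ}
    (hUm : ∀ i, Measurable (U i)) (hUi : iIndepFun U P)
    (hU : ∀ i, pdf.IsUniform (U i) (Set.Icc (0 : ℝ) 1) P volume) {w : ℕ → ℝ}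
    (hw : ∀ i, w i ∈ Set.Ioo (0 : ℝ) 1) (n j m : ℕ) {A : Finset ℕ} (hA : A ⊆ Finset.range n) :
    P {ω | (w, fun i => U i ω) ∈ stateSet n j m A ∧ remaining w (fun i => U i ω) n (j + 1) = A}
      = ENNReal.ofReal (w j ^ A.card) * P {ω | (w, fun i => U i ω) ∈ stateSet n j m A} := by
  obtain ⟨α, hα⟩ := exists_measure_state_inter hUm hUi hU hw n j m A
  have h1 := hα (Set.Iic (T w (j + 1))) measurableSet_Iic
    (Set.Iic_subset_Iic.2 (T_antitone hw (Nat.le_succ j)))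
  have h0 := hα (Set.Iic (T w j)) measurableSet_Iic le_rfl
  rw [measure_uniform_Iic (hUm 0) (hU 0) (T_le_one hw _)] at h0 h1
  have e1 : {ω | (w, fun i => U i ω) ∈ stateSet n j m A ∧
        remaining w (fun i => U i ω) n (j + 1) = A}
      = {ω | (w, fun i => U i ω) ∈ stateSet n j m A ∧ ∀ i ∈ A, U i ω ∈ Set.Iic (T w (j + 1))} := by
    ext ω
    simp only [Set.mem_ofPred_eq]
    refine and_congr_right fun h => ⟨fun h1 i hi => ?_, fun h1 => ?_⟩
    · rw [← h1, mem_remaining] at hi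
      exact hi.2
    · refine Finset.Subset.antisymm ?_ fun i hi => mem_remaining.2
        ⟨Finset.mem_range.1 (hA hi), h1 i hi⟩
      have h2 := remaining_antitone (u := fun i => U i ω) (n := n) hw (Nat.le_succ j)
      rwa [show remaining w (fun i => U i ω) n j = A from h.2] at h2
  have e0 : {ω | (w, fun i => U i ω) ∈ stateSet n j m A}
      = {ω | (w, fun i => U i ω) ∈ stateSet n j m A ∧ ∀ i ∈ A, U i ω ∈ Set.Iic (T w j)} := by
    ext ω
    simp only [Set.mem_ofPred_eq]
    refine ⟨fun h => ⟨h, fun i hi => ?_⟩, fun h => h.1⟩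
    rw [← show remaining w (fun i => U i ω) n j = A from h.2, mem_remaining] at hi
    exact hi.2
  rw [e1, h1, e0, h0, T_succ, ENNReal.ofReal_mul (T_pos hw j).le, ENNReal.ofReal_pow (hw j).1.le,
    mul_pow]
  ring

/-- All remaining balls fall into the next box with conditional probability `(1 - w_j) ^ |A|`. -/
lemma measure_state_exit [IsProbabilityMeasure P] {U : ℕ → Ω → ℝ}
    (hUm : ∀ i, Measurable (U i)) (hUi : iIndepFun U P)
    (hU : ∀ i, pdf.IsUniform (U i) (Set.Icc (0 : ℝ) 1) P volume) {w : ℕ → ℝ}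
    (hw : ∀ i, w i ∈ Set.Ioo (0 : ℝ) 1) (n j m : ℕ) {A : Finset ℕ} (hA : A ⊆ Finset.range n) :
    P {ω | (w, fun i => U i ω) ∈ stateSet n j m A ∧ remaining w (fun i => U i ω) n (j + 1) = ∅}
      = ENNReal.ofReal ((1 - w j) ^ A.card) * P {ω | (w, fun i => U i ω) ∈ stateSet n j m A} := by
  obtain ⟨α, hα⟩ := exists_measure_state_inter hUm hUi hU hw n j m A
  have h1 := hα (Set.Ioc (T w (j + 1)) (T w j)) measurableSet_Ioc Set.Ioc_subset_Iic_self
  have h0 := hα (Set.Iic (T w j)) measurableSet_Iic le_rfl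
  rw [measure_uniform_Iic (hUm 0) (hU 0) (T_le_one hw _)] at h0
  rw [measure_uniform_Ioc (hUm 0) (hU 0) (T_pos hw _).le (T_le_one hw _)] at h1
  have e1 : {ω | (w, fun i => U i ω) ∈ stateSet n j m A ∧
        remaining w (fun i => U i ω) n (j + 1) = ∅}
      = {ω | (w, fun i => U i ω) ∈ stateSet n j m A ∧
        ∀ i ∈ A, U i ω ∈ Set.Ioc (T w (j + 1)) (T w j)} := by
    ext ω
    simp only [Set.mem_ofPred_eq]
    refine and_congr_right fun h => ⟨fun h1 i hi => ⟨?_, ?_⟩, fun h1 => ?_⟩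
    · by_contra! h2
      have h3 : i ∈ remaining w (fun i => U i ω) n (j + 1) :=
        mem_remaining.2 ⟨Finset.mem_range.1 (hA hi), h2⟩
      rw [h1] at h3
      simp at h3
    · rw [← show remaining w (fun i => U i ω) n j = A from h.2, mem_remaining] at hi
      exact hi.2
    · rw [Finset.eq_empty_iff_forall_notMem]
      intro i hi
      have h2 := remaining_antitone (u := fun i => U i ω) (n := n) hw (Nat.le_succ j) hi
      rw [show remaining w (fun i => U i ω) n j = A from h.2] at h2
      exact absurd (mem_remaining.1 hi).2 (not_le.2 (h1 i h2).1)
  have e0 : {ω | (w, fun i => U i ω) ∈ stateSet n j m A}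
      = {ω | (w, fun i => U i ω) ∈ stateSet n j m A ∧ ∀ i ∈ A, U i ω ∈ Set.Iic (T w j)} := by
    ext ω
    simp only [Set.mem_ofPred_eq]
    refine ⟨fun h => ⟨h, fun i hi => ?_⟩, fun h => h.1⟩
    rw [← show remaining w (fun i => U i ω) n j = A from h.2, mem_remaining] at hi
    exact hi.2
  have hT : T w j - T w (j + 1) = T w j * (1 - w j) := by rw [T_succ]; ring
  rw [e1, h1, e0, h0, hT, ENNReal.ofReal_mul (T_pos hw j).le,
    ENNReal.ofReal_pow (by linarith [(hw j).2]), mul_pow]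
  ring

lemma measure_remaining_eq [IsProbabilityMeasure P] {U : ℕ → Ω → ℝ}
    (hUm : ∀ i, Measurable (U i)) (hUi : iIndepFun U P)
    (hU : ∀ i, pdf.IsUniform (U i) (Set.Icc (0 : ℝ) 1) P volume) {w : ℕ → ℝ}
    (hw : ∀ i, w i ∈ Set.Ioo (0 : ℝ) 1) (n j : ℕ) {A : Finset ℕ} (hA : A ⊆ Finset.range n) :
    P {ω | remaining w (fun i => U i ω) n j = A}
      = ENNReal.ofReal (T w j ^ A.card * (1 - T w j) ^ (n - A.card)) := by
  classical
  have e : {ω | remaining w (fun i => U i ω) n j = A} = ⋂ i ∈ Finset.range n,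
      U i ⁻¹' (if i ∈ A then Set.Iic (T w j) else Set.Ioi (T w j)) := by
    ext ω
    simp only [Set.mem_ofPred_eq, Set.mem_iInter, Set.mem_preimage, Finset.ext_iff, mem_remaining,
      Finset.mem_range]
    refine forall_congr' fun i => ⟨fun h hi => ?_, fun h => ⟨fun h1 => ?_, fun h1 => ?_⟩⟩
    · split_ifs with hiA
      · exact (h.2 hiA).2
      · exact lt_of_not_ge fun h2 => hiA (h.1 ⟨hi, h2⟩)
    · by_contra hiA
      have h2 := h h1.1
      rw [if_neg hiA] at h2
      exact absurd h1.2 (not_le.2 h2)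
    · have hi := Finset.mem_range.1 (hA h1)
      have h2 := h hi
      rw [if_pos h1] at h2
      exact ⟨hi, h2⟩
  rw [e, hUi.measure_inter_preimage_eq_mul (Finset.range n)
    (sets := fun i => if i ∈ A then Set.Iic (T w j) else Set.Ioi (T w j))
    (fun i _ => by split_ifs; exacts [measurableSet_Iic, measurableSet_Ioi])]
  have h1 : ∀ i ∈ Finset.range n, P (U i ⁻¹' (if i ∈ A then Set.Iic (T w j) else Set.Ioi (T w j)))
      = if i ∈ A then ENNReal.ofReal (T w j) else ENNReal.ofReal (1 - T w j) := by
    intro i _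
    split_ifs
    · exact measure_uniform_Iic (hUm i) (hU i) (T_le_one hw j)
    · exact measure_uniform_Ioi (hUm i) (hU i) (T_pos hw j).le
  rw [Finset.prod_congr rfl h1, Finset.prod_ite, Finset.prod_const, Finset.prod_const,
    ENNReal.ofReal_mul (pow_nonneg (T_pos hw j).le _), ENNReal.ofReal_pow (T_pos hw j).le,
    ENNReal.ofReal_pow (by linarith [T_le_one hw j])]
  congr 2
  · rw [Finset.filter_mem_eq_inter, Finset.inter_eq_right.2 hA]
  · rw [Finset.filter_not, Finset.filter_mem_eq_inter, Finset.inter_eq_right.2 hA,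
      Finset.card_sdiff_of_subset hA, Finset.card_range]

/-! ### One step of the chain for random box sizes -/

variable {Ω₀ : Type*} [MeasurableSpace Ω₀] {P₀ : Measure Ω₀} {W : Ω₀ → ℝ} {Wseq U : ℕ → Ω → ℝ}

lemma IsBernoulliSieve.map_Wseq (hs : IsBernoulliSieve P₀ W P Wseq U) (k : ℕ) :
    P.map (Wseq k) = P₀.map W := (hs.identDistrib k).map_eq

lemma IsBernoulliSieve.ae_mem_Ioo_map (hs : IsBernoulliSieve P₀ W P Wseq U) :
    ∀ᵐ w ∂(P₀.map W), w ∈ Set.Ioo (0 : ℝ) 1 :=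
  (ae_map_iff hs.measurable_W.aemeasurable measurableSet_Ioo).2 hs.mem_Ioo

lemma IsBernoulliSieve.ae_Wseq_mem (hs : IsBernoulliSieve P₀ W P Wseq U) :
    ∀ᵐ ω ∂P, ∀ k, Wseq k ω ∈ Set.Ioo (0 : ℝ) 1 := by
  rw [ae_all_iff]
  intro k
  refine (ae_map_iff (p := fun x => x ∈ Set.Ioo (0 : ℝ) 1) (hs.measurable_Wseq k).aemeasurable
    measurableSet_Ioo).1 ?_
  rw [hs.map_Wseq k]
  exact hs.ae_mem_Ioo_map

lemma IsBernoulliSieve.measurable_Wseq_pi (hs : IsBernoulliSieve P₀ W P Wseq U) :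
    Measurable fun ω k => Wseq k ω := measurable_pi_lambda _ hs.measurable_Wseq

lemma IsBernoulliSieve.measurable_U_pi (hs : IsBernoulliSieve P₀ W P Wseq U) :
    Measurable fun ω k => U k ω := measurable_pi_lambda _ hs.measurable_U

/-- Integration over the balls first. -/
lemma IsBernoulliSieve.measure_eq_lintegral [IsProbabilityMeasure P]
    (hs : IsBernoulliSieve P₀ W P Wseq U) {S : Set ((ℕ → ℝ) × (ℕ → ℝ))} (hS : MeasurableSet S) :
    P {ω | ((fun k => Wseq k ω), fun k => U k ω) ∈ S}
      = ∫⁻ ω, P {ω' | ((fun k => Wseq k ω), fun k => U k ω') ∈ S} ∂P := by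
  have h := (indepFun_iff_map_prod_eq_prod_map_map hs.measurable_Wseq_pi.aemeasurable
    hs.measurable_U_pi.aemeasurable).1 hs.indep_Wseq_U
  have hm := hs.measurable_Wseq_pi.prodMk hs.measurable_U_pi
  have h1 := congrArg (fun μ => μ S) h
  simp only [Measure.map_apply hm hS] at h1
  have := Measure.isProbabilityMeasure_map (μ := P) hs.measurable_U_pi.aemeasurable
  rw [Measure.prod_apply hS, lintegral_map (measurable_measure_prodMk_left hS)
    hs.measurable_Wseq_pi] at h1
  refine Eq.trans h1 (lintegral_congr fun ω => ?_)
  rw [Measure.map_apply hs.measurable_U_pi (measurable_prodMk_left hS)]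
  rfl

/-- If, given the box sizes, the event `S` has conditional probability `φ (w_j)` relative to an event
`S₀` that involves only the first `j` boxes, then its probability relative to `S₀` is `E φ(W)`. -/
lemma IsBernoulliSieve.measure_step [IsProbabilityMeasure P]
    (hs : IsBernoulliSieve P₀ W P Wseq U) {S S₀ : Set ((ℕ → ℝ) × (ℕ → ℝ))} (hS : MeasurableSet S)
    (hS₀ : MeasurableSet S₀) {j : ℕ} {φ : ℝ → ℝ≥0∞} (hφ : Measurable φ)
    (hdep : ∀ w w' u, (∀ i < j, w i = w' i) → (w, u) ∈ S₀ → (w', u) ∈ S₀)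
    (hstep : ∀ w : ℕ → ℝ, (∀ i, w i ∈ Set.Ioo (0 : ℝ) 1) →
      P {ω | (w, fun k => U k ω) ∈ S} = φ (w j) * P {ω | (w, fun k => U k ω) ∈ S₀}) :
    P {ω | ((fun k => Wseq k ω), fun k => U k ω) ∈ S}
      = (∫⁻ w, φ w ∂(P₀.map W)) * P {ω | ((fun k => Wseq k ω), fun k => U k ω) ∈ S₀} := by
  classical
  rw [hs.measure_eq_lintegral hS, hs.measure_eq_lintegral hS₀]
  let p : (ℕ → ℝ) → ℝ≥0∞ := fun w => P {ω' | (w, fun k => U k ω') ∈ S₀}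
  have hp : Measurable p := by
    have := Measure.isProbabilityMeasure_map (μ := P) hs.measurable_U_pi.aemeasurable
    convert! measurable_measure_prodMk_left (ν := P.map fun ω k => U k ω) hS₀ using 1
    funext w
    rw [Measure.map_apply hs.measurable_U_pi (measurable_prodMk_left hS₀)]
    rfl
  let ext' : (Finset.range j → ℝ) → ℕ → ℝ := fun v i =>
    if h : i ∈ Finset.range j then v ⟨i, h⟩ else 0
  have hext : Measurable ext' := by
    refine measurable_pi_lambda _ fun i => ?_
    by_cases h : i ∈ Finset.range j
    · simp only [ext', h, dif_pos]; exact measurable_pi_apply _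
    · simp only [ext', h, dif_neg, not_false_eq_true]; exact measurable_const
  have hpext : ∀ ω, p (fun k => Wseq k ω) = p (ext' fun i => Wseq i ω) := by
    intro ω
    have hag : ∀ i < j, Wseq i ω = ext' (fun i => Wseq i ω) i := fun i hi => by
      simp [ext', hi]
    refine congrArg P (Set.ext fun ω' => ⟨?_, ?_⟩)
    · exact hdep _ _ _ hag
    · exact hdep _ _ _ fun i hi => (hag i hi).symm
  have hind : IndepFun (fun ω => φ (Wseq j ω)) (fun ω => p (ext' fun i => Wseq i ω)) P := by
    have h1 := hs.indep_Wseq.indepFun_finset {j} (Finset.range j) (by simp) hs.measurable_Wseq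
    exact h1.comp (φ := fun v : ({j} : Finset ℕ) → ℝ => φ (v ⟨j, Finset.mem_singleton_self j⟩))
      (hφ.comp (measurable_pi_apply _)) (hp.comp hext)
  have hm2 : Measurable fun ω => p (ext' fun i => Wseq i ω) :=
    (hp.comp hext).comp (measurable_pi_lambda _ fun i => hs.measurable_Wseq i)
  calc ∫⁻ ω, P {ω' | ((fun k => Wseq k ω), fun k => U k ω') ∈ S} ∂P
      = ∫⁻ ω, φ (Wseq j ω) * p (ext' fun i => Wseq i ω) ∂P :=
        lintegral_congr_ae (hs.ae_Wseq_mem.mono fun ω hω => by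
          simp only [← hpext ω]; exact hstep _ hω)
    _ = (∫⁻ ω, φ (Wseq j ω) ∂P) * ∫⁻ ω, p (ext' fun i => Wseq i ω) ∂P :=
        lintegral_mul_eq_lintegral_mul_lintegral_of_indepFun (hφ.comp (hs.measurable_Wseq j))
          hm2 hind
    _ = _ := by
        congr 1
        · rw [← hs.map_Wseq j, lintegral_map hφ (hs.measurable_Wseq j)]
        · exact lintegral_congr fun ω => (hpext ω).symm

lemma T_congr {w w' : ℕ → ℝ} {j : ℕ} (h : ∀ i < j, w i = w' i) {l : ℕ} (hl : l ≤ j) :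
    T w l = T w' l :=
  Finset.prod_congr rfl fun i hi => h i ((Finset.mem_range.1 hi).trans_le hl)

lemma remaining_congr {w w' : ℕ → ℝ} {j : ℕ} (h : ∀ i < j, w i = w' i) (u : ℕ → ℝ) (n : ℕ) {l : ℕ}
    (hl : l ≤ j) : remaining w u n l = remaining w' u n l := by
  rw [remaining, remaining, T_congr h hl]

lemma stateSet_congr {w w' : ℕ → ℝ} {j : ℕ} (h : ∀ i < j, w i = w' i) (u : ℕ → ℝ) {n m : ℕ}
    {A : Finset ℕ} (hmem : (w, u) ∈ stateSet n j m A) : (w', u) ∈ stateSet n j m A := by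
  simp only [stateSet, Set.mem_ofPred_eq] at hmem ⊢
  rw [← remaining_congr h u n le_rfl]
  refine ⟨?_, hmem.2⟩
  rw [← hmem.1]
  unfold loops
  congr 1
  refine Finset.filter_congr fun i hi => ?_
  rw [Finset.mem_range] at hi
  rw [remaining_congr h u n hi.le, remaining_congr h u n (Nat.succ_le_of_lt hi)]

lemma IsBernoulliSieve.measure_stay [IsProbabilityMeasure P]
    (hs : IsBernoulliSieve P₀ W P Wseq U) (n j m : ℕ) {A : Finset ℕ} (hA : A ⊆ Finset.range n) :
    P {ω | ((fun k => Wseq k ω), fun k => U k ω) ∈ stateSet n j m A ∧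
        remaining (fun k => Wseq k ω) (fun k => U k ω) n (j + 1) = A}
      = (∫⁻ w, ENNReal.ofReal (w ^ A.card) ∂(P₀.map W)) *
        P {ω | ((fun k => Wseq k ω), fun k => U k ω) ∈ stateSet n j m A} :=
  hs.measure_step (φ := fun x => ENNReal.ofReal (x ^ A.card))
    ((measurableSet_stateSet n j m A).inter (measurableSet_remaining_eq n (j + 1) A))
    (measurableSet_stateSet n j m A) (by fun_prop) (fun _ _ u h => stateSet_congr h u)
    fun _ hw => measure_state_stay hs.measurable_U hs.indep_U hs.uniform_U hw n j m hA

lemma IsBernoulliSieve.measure_exit [IsProbabilityMeasure P]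
    (hs : IsBernoulliSieve P₀ W P Wseq U) (n j m : ℕ) {A : Finset ℕ} (hA : A ⊆ Finset.range n) :
    P {ω | ((fun k => Wseq k ω), fun k => U k ω) ∈ stateSet n j m A ∧
        remaining (fun k => Wseq k ω) (fun k => U k ω) n (j + 1) = ∅}
      = (∫⁻ w, ENNReal.ofReal ((1 - w) ^ A.card) ∂(P₀.map W)) *
        P {ω | ((fun k => Wseq k ω), fun k => U k ω) ∈ stateSet n j m A} :=
  hs.measure_step (φ := fun x => ENNReal.ofReal ((1 - x) ^ A.card))
    ((measurableSet_stateSet n j m A).inter (measurableSet_remaining_eq n (j + 1) ∅))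
    (measurableSet_stateSet n j m A) (by fun_prop) (fun _ _ u h => stateSet_congr h u)
    fun _ hw => measure_state_exit hs.measurable_U hs.indep_U hs.uniform_U hw n j m hA

/-! ### The expected number of visits -/

lemma IsBernoulliSieve.lintegral_T [IsProbabilityMeasure P₀] [IsProbabilityMeasure P]
    (hs : IsBernoulliSieve P₀ W P Wseq U) {g : ℝ → ℝ≥0∞} (hg : Measurable g) (j : ℕ) (x : ℝ) :
    ∫⁻ ω, g (x * T (fun k => Wseq k ω) j) ∂P = (avg (P₀.map W))^[j] g x := by
  have := Measure.isProbabilityMeasure_map (μ := P₀) hs.measurable_W.aemeasurable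
  have hTm : ∀ j, Measurable fun ω => T (fun k => Wseq k ω) j := fun j =>
    (measurable_T j).comp hs.measurable_Wseq_pi
  induction j generalizing g with
  | zero => simp [T_zero]
  | succ j ih =>
    rw [Function.iterate_succ_apply, ← ih (measurable_avg hg)]
    have hind : IndepFun (fun ω => T (fun k => Wseq k ω) j) (Wseq j) P := by
      have h1 := hs.indep_Wseq.indepFun_prod_range_succ hs.measurable_Wseq j
      convert h1 using 1
      funext ω
      simp [T]
    have h2 := (indepFun_iff_map_prod_eq_prod_map_map (hTm j).aemeasurable
      (hs.measurable_Wseq j).aemeasurable).1 hind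
    rw [hs.map_Wseq j] at h2
    have hgm : Measurable fun p : ℝ × ℝ => g (x * (p.1 * p.2)) := by fun_prop
    have h3 := lintegral_map (μ := P) hgm ((hTm j).prodMk (hs.measurable_Wseq j))
    have := Measure.isProbabilityMeasure_map (μ := P) (hTm j).aemeasurable
    rw [h2, lintegral_prod _ hgm.aemeasurable, lintegral_map hgm.lintegral_prod_right'
      (hTm j)] at h3
    simp only [T_succ]
    rw [← h3]
    refine lintegral_congr fun ω => ?_
    simp only [avg, mul_assoc]

/-- For fixed `k`, the expected number of `j` for which exactly `k` balls remain after `j` boxes is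
bounded by the potential of the bump at `n`, up to a constant. -/
lemma IsBernoulliSieve.exists_sum_measure_remaining_le [IsProbabilityMeasure P₀]
    [IsProbabilityMeasure P] (hs : IsBernoulliSieve P₀ W P Wseq U) {k : ℕ} (hk : 1 ≤ k) :
    ∃ C : ℝ≥0∞, C ≠ ∞ ∧ ∀ n J : ℕ, ∑ j ∈ Finset.range J, ∑ A ∈ (Finset.range n).powersetCard k,
      P {ω | remaining (fun i => Wseq i ω) (fun i => U i ω) n j = A}
        ≤ C * potential (P₀.map W) bump n := by
  refine ⟨ENNReal.ofReal (Real.exp k) * ENNReal.ofReal (2 ^ k * k.factorial),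
    ENNReal.mul_ne_top ENNReal.ofReal_ne_top ENNReal.ofReal_ne_top, fun n J => ?_⟩
  set C : ℝ≥0∞ := ENNReal.ofReal (Real.exp k) * ENNReal.ofReal (2 ^ k * k.factorial) with hC
  have hj : ∀ j, ∑ A ∈ (Finset.range n).powersetCard k,
      P {ω | remaining (fun i => Wseq i ω) (fun i => U i ω) n j = A}
        ≤ C * (avg (P₀.map W))^[j] bump n := by
    intro j
    have hTm : Measurable fun ω => T (fun k => Wseq k ω) j :=
      (measurable_T j).comp hs.measurable_Wseq_pi
    have hA : ∀ A ∈ (Finset.range n).powersetCard k,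
        P {ω | remaining (fun i => Wseq i ω) (fun i => U i ω) n j = A}
          = ∫⁻ ω, ENNReal.ofReal (T (fun i => Wseq i ω) j ^ k *
            (1 - T (fun i => Wseq i ω) j) ^ (n - k)) ∂P := by
      intro A hA
      rw [Finset.mem_powersetCard] at hA
      refine (hs.measure_eq_lintegral (measurableSet_remaining_eq n j A)).trans ?_
      refine lintegral_congr_ae (hs.ae_Wseq_mem.mono fun ω hω => ?_)
      simp only
      rw [← hA.2]
      exact measure_remaining_eq hs.measurable_U hs.indep_U hs.uniform_U hω n j hA.1
    rw [Finset.sum_congr rfl hA, Finset.sum_const, Finset.card_powersetCard, Finset.card_range,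
      nsmul_eq_mul, ← hs.lintegral_T measurable_bump, ← lintegral_const_mul _ (by fun_prop),
      ← lintegral_const_mul _ (by fun_prop)]
    refine lintegral_mono_ae (hs.ae_Wseq_mem.mono fun ω hω => ?_)
    set t := T (fun i => Wseq i ω) j with ht
    have ht0 : 0 < t := T_pos hω j
    have ht1 : t ≤ 1 := T_le_one hω j
    rcases lt_or_ge n k with hnk | hnk
    · rw [Nat.choose_eq_zero_of_lt hnk]
      simp
    have hb := pow_mul_exp_neg_le_bump hk (x := n * t) (by positivity)
    calc ((n.choose k : ℕ) : ℝ≥0∞) * ENNReal.ofReal (t ^ k * (1 - t) ^ (n - k))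
        = ENNReal.ofReal ((n.choose k : ℕ) * (t ^ k * (1 - t) ^ (n - k))) := by
          rw [ENNReal.ofReal_mul (Nat.cast_nonneg _), ENNReal.ofReal_natCast]
      _ ≤ ENNReal.ofReal (Real.exp k * ((n * t) ^ k * Real.exp (-(n * t)))) := by
          apply ENNReal.ofReal_le_ofReal
          have h1 : ((n.choose k : ℕ) : ℝ) ≤ (n : ℝ) ^ k := by
            exact_mod_cast Nat.choose_le_pow n k
          have h2 : (1 - t) ^ (n - k) ≤ Real.exp k * Real.exp (-(n * t)) := by
            calc (1 - t) ^ (n - k) ≤ Real.exp (-t) ^ (n - k) :=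
                  pow_le_pow_left₀ (by linarith) (Real.one_sub_le_exp_neg t) _
              _ = Real.exp (-((n : ℝ) - k) * t) := by
                  rw [← Real.exp_nat_mul, Nat.cast_sub hnk]; ring_nf
              _ ≤ Real.exp (k + -(n * t)) := by
                  rw [Real.exp_le_exp]
                  have : (k : ℝ) * t ≤ k := mul_le_of_le_one_right (Nat.cast_nonneg k) ht1
                  linarith
              _ = _ := Real.exp_add _ _
          have h3 : 0 ≤ (1 - t) ^ (n - k) := pow_nonneg (by linarith) _
          calc ((n.choose k : ℕ) : ℝ) * (t ^ k * (1 - t) ^ (n - k))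
              ≤ (n : ℝ) ^ k * (t ^ k * (Real.exp k * Real.exp (-(n * t)))) := by gcongr
            _ = _ := by rw [mul_pow]; ring
      _ = ENNReal.ofReal (Real.exp k) * ENNReal.ofReal ((n * t) ^ k * Real.exp (-(n * t))) :=
          ENNReal.ofReal_mul (Real.exp_pos _).le
      _ ≤ C * bump (n * t) := by
          rw [hC, mul_assoc]
          gcongr
  refine (Finset.sum_le_sum fun j _ => hj j).trans ?_
  rw [← Finset.mul_sum]
  gcongr
  exact ENNReal.sum_le_tsum _

/-! ### The one-step identities in integrated form -/

/-- The random set of balls remaining after `j` boxes. -/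
noncomputable abbrev remainingAt (Wseq U : ℕ → Ω → ℝ) (n j : ℕ) (ω : Ω) : Finset ℕ :=
  remaining (fun k => Wseq k ω) (fun k => U k ω) n j

/-- The random number of empty boxes among the first `j` that have balls after them. -/
noncomputable abbrev loopsAt (Wseq U : ℕ → Ω → ℝ) (n j : ℕ) (ω : Ω) : ℕ :=
  loops (fun k => Wseq k ω) (fun k => U k ω) n j

lemma IsBernoulliSieve.measurableSet_remainingAt (hs : IsBernoulliSieve P₀ W P Wseq U) (n j : ℕ)
    (A : Finset ℕ) : MeasurableSet {ω | remainingAt Wseq U n j ω = A} :=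
  (hs.measurable_Wseq_pi.prodMk hs.measurable_U_pi) (measurableSet_remaining_eq n j A)

lemma IsBernoulliSieve.measurable_loopsAt (hs : IsBernoulliSieve P₀ W P Wseq U) (n j : ℕ) :
    Measurable fun ω => loopsAt Wseq U n j ω := by
  have h := (measurable_loops n j).comp (hs.measurable_Wseq_pi.prodMk hs.measurable_U_pi)
  exact h

lemma setIntegral_comp_eq_mul {X : Ω → ℕ} (hX : Measurable X) {S S' : Set Ω}
    {a : ℝ≥0∞}
    (h : ∀ m, P ({ω | X ω = m} ∩ S') = a * P ({ω | X ω = m} ∩ S)) (D : ℕ → ℝ) :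
    ∫ ω in S', D (X ω) ∂P = a.toReal * ∫ ω in S, D (X ω) ∂P := by
  have hmap : (P.restrict S').map X = a • (P.restrict S).map X := by
    refine Measure.ext_of_singleton fun m => ?_
    rw [Measure.smul_apply, Measure.map_apply hX (measurableSet_singleton m),
      Measure.map_apply hX (measurableSet_singleton m),
      Measure.restrict_apply (hX (measurableSet_singleton m)),
      Measure.restrict_apply (hX (measurableSet_singleton m))]
    exact h m
  have hD : ∀ μ : Measure ℕ, AEStronglyMeasurable D μ := fun μ =>
    (measurable_of_countable D).aestronglyMeasurable
  rw [← integral_map hX.aemeasurable (hD _), ← integral_map hX.aemeasurable (hD _), hmap,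
    integral_smul_measure, smul_eq_mul]

lemma IsBernoulliSieve.toReal_lintegral_map (hs : IsBernoulliSieve P₀ W P Wseq U) {φ : ℝ → ℝ}
    (hφ : Measurable φ) (hφ0 : ∀ x ∈ Set.Ioo (0 : ℝ) 1, 0 ≤ φ x) :
    (∫⁻ w, ENNReal.ofReal (φ w) ∂(P₀.map W)).toReal = ∫ ω, φ (W ω) ∂P₀ := by
  rw [lintegral_map (by fun_prop) hs.measurable_W, integral_eq_lintegral_of_nonneg_ae]
  · exact hs.mem_Ioo.mono fun ω hω => hφ0 _ hω
  · exact (hφ.comp hs.measurable_W).aestronglyMeasurable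

lemma IsBernoulliSieve.setIntegral_stay [IsProbabilityMeasure P]
    (hs : IsBernoulliSieve P₀ W P Wseq U) (n j : ℕ) {A : Finset ℕ} (hA : A ⊆ Finset.range n)
    (D : ℕ → ℝ) :
    ∫ ω in {ω | remainingAt Wseq U n j ω = A} ∩ {ω | remainingAt Wseq U n (j + 1) ω = A},
        D (loopsAt Wseq U n j ω) ∂P
      = (∫ ω, W ω ^ A.card ∂P₀) *
        ∫ ω in {ω | remainingAt Wseq U n j ω = A}, D (loopsAt Wseq U n j ω) ∂P := by
  rw [← hs.toReal_lintegral_map (φ := fun x => x ^ A.card) (by fun_prop)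
    fun x hx => pow_nonneg hx.1.le _]
  refine setIntegral_comp_eq_mul (hs.measurable_loopsAt n j) (fun m => ?_) D
  rw [← Set.inter_assoc]
  exact hs.measure_stay n j m hA

lemma IsBernoulliSieve.setIntegral_exit [IsProbabilityMeasure P]
    (hs : IsBernoulliSieve P₀ W P Wseq U) (n j : ℕ) {A : Finset ℕ} (hA : A ⊆ Finset.range n)
    (D : ℕ → ℝ) :
    ∫ ω in {ω | remainingAt Wseq U n j ω = A} ∩ {ω | remainingAt Wseq U n (j + 1) ω = ∅},
        D (loopsAt Wseq U n j ω) ∂P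
      = (∫ ω, (1 - W ω) ^ A.card ∂P₀) *
        ∫ ω in {ω | remainingAt Wseq U n j ω = A}, D (loopsAt Wseq U n j ω) ∂P := by
  rw [← hs.toReal_lintegral_map (φ := fun x => (1 - x) ^ A.card) (by fun_prop)
    fun x hx => pow_nonneg (by linarith [hx.2]) _]
  refine setIntegral_comp_eq_mul (hs.measurable_loopsAt n j) (fun m => ?_) D
  rw [← Set.inter_assoc]
  exact hs.measure_exit n j m hA

/-- The nonempty sets of balls among the first `n`. -/
def nonemptySets (n : ℕ) : Finset (Finset ℕ) := (Finset.range n).powerset.erase ∅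

lemma mem_nonemptySets {n : ℕ} {A : Finset ℕ} :
    A ∈ nonemptySets n ↔ A ≠ ∅ ∧ A ⊆ Finset.range n := by
  simp [nonemptySets]

/-- Exits from different states are disjoint events, so the expected number of exits is at
most `1`. -/
lemma IsBernoulliSieve.sum_exit_le_one [IsProbabilityMeasure P]
    (hs : IsBernoulliSieve P₀ W P Wseq U) (n J : ℕ) :
    ∑ j ∈ Finset.range J, ∑ A ∈ nonemptySets n,
      (∫ ω, (1 - W ω) ^ A.card ∂P₀) * P.real {ω | remainingAt Wseq U n j ω = A} ≤ 1 := by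
  have hstep : ∀ j, ∑ A ∈ nonemptySets n,
      (∫ ω, (1 - W ω) ^ A.card ∂P₀) * P.real {ω | remainingAt Wseq U n j ω = A}
      ≤ P.real {ω | remainingAt Wseq U n (j + 1) ω = ∅}
        - P.real {ω | remainingAt Wseq U n j ω = ∅} := by
    intro j
    have h1 : ∀ A ∈ nonemptySets n,
        (∫ ω, (1 - W ω) ^ A.card ∂P₀) * P.real {ω | remainingAt Wseq U n j ω = A}
        = P.real ({ω | remainingAt Wseq U n j ω = A} ∩
          {ω | remainingAt Wseq U n (j + 1) ω = ∅}) := by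
      intro A hA
      have := hs.setIntegral_exit n j (mem_nonemptySets.1 hA).2 (fun _ => 1)
      simpa using this.symm
    have h2 : P.real {ω | remainingAt Wseq U n j ω = ∅}
        = P.real ({ω | remainingAt Wseq U n j ω = ∅} ∩
          {ω | remainingAt Wseq U n (j + 1) ω = ∅}) := by
      refine measureReal_congr ?_
      filter_upwards [hs.ae_Wseq_mem] with ω hω
      refine propext ⟨fun h => ⟨h, ?_⟩, fun h => h.1⟩
      have h3 : remainingAt Wseq U n j ω = ∅ := h
      have h4 := remaining_antitone (u := fun k => U k ω) (n := n) hω (Nat.le_succ j)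
      change remainingAt Wseq U n (j + 1) ω ⊆ remainingAt Wseq U n j ω at h4
      rw [h3] at h4
      exact Finset.subset_empty.1 h4
    rw [Finset.sum_congr rfl h1, le_sub_iff_add_le, h2, nonemptySets,
      Finset.sum_erase_add _ _ (Finset.empty_mem_powerset _),
      ← measureReal_biUnion_finset]
    · refine measureReal_mono (Set.iUnion₂_subset fun A _ => Set.inter_subset_right)
    · intro A _ B _ hAB
      refine Set.disjoint_left.2 fun ω h3 h4 => hAB ?_
      have h5 : remainingAt Wseq U n j ω = A := h3.1
      have h6 : remainingAt Wseq U n j ω = B := h4.1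
      exact h5.symm.trans h6
    · intro A _
      exact (hs.measurableSet_remainingAt n j A).inter
        (hs.measurableSet_remainingAt n (j + 1) ∅)
  refine (Finset.sum_le_sum fun j _ => hstep j).trans ?_
  rw [Finset.sum_range_sub (fun j => P.real {ω | remainingAt Wseq U n j ω = ∅})]
  linarith [measureReal_nonneg (μ := P) (s := {ω | remainingAt Wseq U n 0 ω = ∅}),
    measureReal_le_one (μ := P) (s := {ω | remainingAt Wseq U n J ω = ∅})]

lemma IsBernoulliSieve.sum_measureReal_le [IsProbabilityMeasure P₀] [IsProbabilityMeasure P]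
    (hs : IsBernoulliSieve P₀ W P Wseq U) (hpot : ∀ x, potential (P₀.map W) bump x ≠ ∞) {k : ℕ}
    (hk : 1 ≤ k) :
    ∃ C : ℝ, ∀ n J : ℕ, ∑ j ∈ Finset.range J, ∑ A ∈ (Finset.range n).powersetCard k,
      P.real {ω | remainingAt Wseq U n j ω = A}
        ≤ C * (potential (P₀.map W) bump n).toReal := by
  obtain ⟨C, hC, h⟩ := hs.exists_sum_measure_remaining_le hk
  refine ⟨C.toReal, fun n J => ?_⟩
  have h1 := ENNReal.toReal_mono (ENNReal.mul_ne_top hC (hpot n)) (h n J)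
  rw [ENNReal.toReal_mul, ENNReal.toReal_sum
    (fun j _ => ENNReal.sum_ne_top.2 fun A _ => measure_ne_top _ _)] at h1
  refine le_of_eq_of_le (Finset.sum_congr rfl fun j _ => ?_) h1
  rw [ENNReal.toReal_sum fun A _ => measure_ne_top _ _]
  rfl

/-- Almost surely the balls run out; here in probability. -/
lemma IsBernoulliSieve.tendsto_measureReal_remaining [IsProbabilityMeasure P₀]
    [IsProbabilityMeasure P] (hs : IsBernoulliSieve P₀ W P Wseq U)
    (hpot : ∀ x, potential (P₀.map W) bump x ≠ ∞) (n : ℕ) :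
    Tendsto (fun j => P.real {ω | remainingAt Wseq U n j ω ≠ ∅}) atTop (𝓝 0) := by
  have hA : ∀ A ∈ nonemptySets n,
      Tendsto (fun j => P.real {ω | remainingAt Wseq U n j ω = A}) atTop (𝓝 0) := by
    intro A hA
    obtain ⟨hA0, hAn⟩ := mem_nonemptySets.1 hA
    obtain ⟨C, hC⟩ := hs.sum_measureReal_le hpot (k := A.card)
      (Finset.card_pos.2 (Finset.nonempty_iff_ne_empty.2 hA0))
    refine (summable_of_sum_range_le (fun j => measureReal_nonneg) (fun J => le_trans ?_
      (hC n J))).tendsto_atTop_zero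
    refine Finset.sum_le_sum fun j _ => ?_
    exact Finset.single_le_sum (f := fun A => P.real {ω | remainingAt Wseq U n j ω = A})
      (fun _ _ => measureReal_nonneg) (Finset.mem_powersetCard.2 ⟨hAn, rfl⟩)
  have hsum := tendsto_finsetSum (nonemptySets n) hA
  rw [Finset.sum_const_zero] at hsum
  refine squeeze_zero (fun _ => measureReal_nonneg) (fun j => ?_) hsum
  refine (measureReal_mono (fun ω hω => ?_) (measure_ne_top _ _)).trans
    (measureReal_biUnion_finset_le _ _)
  have hω' : remainingAt Wseq U n j ω ≠ ∅ := hω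
  exact Set.mem_biUnion (x := remainingAt Wseq U n j ω)
    (mem_nonemptySets.2 ⟨hω', remaining_subset_range _ _ _ _⟩) rfl

lemma IsBernoulliSieve.ae_exists_remaining_eq_empty [IsProbabilityMeasure P₀]
    [IsProbabilityMeasure P] (hs : IsBernoulliSieve P₀ W P Wseq U)
    (hpot : ∀ x, potential (P₀.map W) bump x ≠ ∞) (n : ℕ) :
    ∀ᵐ ω ∂P, ∃ j, remainingAt Wseq U n j ω = ∅ := by
  rw [ae_iff, ← measureReal_eq_zero_iff]
  refine le_antisymm (ge_of_tendsto' (hs.tendsto_measureReal_remaining hpot n) fun j =>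
    measureReal_mono fun ω hω => ?_) measureReal_nonneg
  intro h
  exact hω ⟨j, h⟩

lemma IsBernoulliSieve.aemeasurable_numEmpty [IsProbabilityMeasure P₀]
    [IsProbabilityMeasure P] (hs : IsBernoulliSieve P₀ W P Wseq U)
    (hpot : ∀ x, potential (P₀.map W) bump x ≠ ∞) (n : ℕ) :
    AEMeasurable (fun ω => numEmpty (fun k => Wseq k ω) (fun k => U k ω) n) P := by
  refine aemeasurable_of_tendsto_metrizable_ae' (f := fun j => loopsAt Wseq U n j)
    (fun j => (hs.measurable_loopsAt n j).aemeasurable) ?_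
  filter_upwards [hs.ae_exists_remaining_eq_empty hpot n, hs.ae_Wseq_mem] with ω ⟨j, hj⟩ hω
  refine tendsto_const_nhds.congr' ?_
  filter_upwards [eventually_ge_atTop j] with i hi
  refine numEmpty_eq_loops hω (Finset.subset_empty.1 ?_)
  rw [← hj]
  exact remaining_antitone hω hi

/-! ### The approximate martingale -/

/-- The mean `E F(l + G)` for `G` geometric with success probability `1 / (c + 1)`: the value of the
process in a state in which balls remain. -/
noncomputable def geomShift (c : ℝ) (hc : 0 < c) (F : ℕ → ℝ) (l : ℕ) : ℝ :=
  ∫ m, F (l + m) ∂geometricMeasure (successProb c hc)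

lemma successProb_ne_zero (c : ℝ) (hc : 0 < c) : successProb c hc ≠ 0 := by
  intro h
  have h1 : (1 / (c + 1) : ℝ) = 0 := congrArg Subtype.val h
  have : 0 < 1 / (c + 1) := by positivity
  linarith

lemma abs_geomShift_le (c : ℝ) (hc : 0 < c) {F : ℕ → ℝ} {C : ℝ} (hF : ∀ l, |F l| ≤ C) (l : ℕ) :
    |geomShift c hc F l| ≤ C := by
  unfold geomShift
  have := norm_integral_le_of_norm_le_const (μ := geometricMeasure (successProb c hc))
    (ae_of_all _ fun m => (Real.norm_eq_abs (F (l + m))).trans_le (hF _))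
  simpa using this

/-- The memoryless property: a special step is a success with probability `1 / (c + 1)`. -/
lemma geomShift_rec (c : ℝ) (hc : 0 < c) {F : ℕ → ℝ} {C : ℝ} (hF : ∀ l, |F l| ≤ C) (l : ℕ) :
    F l - geomShift c hc F l = -c * (geomShift c hc F (l + 1) - geomShift c hc F l) := by
  set p : unitInterval := successProb c hc with hp
  have hpv : (p : ℝ) = 1 / (c + 1) := rfl
  have hp0 := successProb_ne_zero c hc
  have hint : ∀ l, Integrable (fun m => F (l + m)) (geometricMeasure p) := fun l =>
    Integrable.of_bound (measurable_of_countable _).aestronglyMeasurable C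
      (ae_of_all _ fun m => (Real.norm_eq_abs (F (l + m))).trans_le (hF _))
  have h0 := hasSum_integral_geometricMeasure hp0 (hint l)
  have h1 := (hasSum_integral_geometricMeasure hp0 (hint (l + 1))).mul_left (1 - (p : ℝ))
  have h2 := (hasSum_nat_add_iff' 1).2 h0
  have h3 : (fun m : ℕ => ((1 - (p : ℝ)) ^ (m + 1) * p) • F (l + (m + 1)))
      = fun m => (1 - (p : ℝ)) * (((1 - (p : ℝ)) ^ m * p) • F (l + 1 + m)) := by
    funext m
    rw [pow_succ', smul_eq_mul, smul_eq_mul, show l + (m + 1) = l + 1 + m by ring]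
    ring
  rw [h3] at h2
  have h4 := h2.unique h1
  simp only [Finset.range_one, Finset.sum_singleton, pow_zero, one_mul, add_zero, smul_eq_mul] at h4
  change geomShift c hc F l - p * F l = (1 - (p : ℝ)) * geomShift c hc F (l + 1) at h4
  rw [hpv] at h4
  field_simp at h4
  linarith

/-- The approximate martingale: `F` of the number of empty boxes seen, with the geometric number
still expected added while balls remain. -/
noncomputable def evalAt (c : ℝ) (hc : 0 < c) (F : ℕ → ℝ) (Wseq U : ℕ → Ω → ℝ) (n j : ℕ) (ω : Ω) :
    ℝ :=
  if remainingAt Wseq U n j ω = ∅ then F (loopsAt Wseq U n j ω)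
  else geomShift c hc F (loopsAt Wseq U n j ω)

lemma IsBernoulliSieve.measurable_evalAt (hs : IsBernoulliSieve P₀ W P Wseq U) (c : ℝ) (hc : 0 < c)
    (F : ℕ → ℝ) (n j : ℕ) : Measurable (evalAt c hc F Wseq U n j) :=
  Measurable.ite (hs.measurableSet_remainingAt n j ∅)
    ((measurable_of_countable F).comp (hs.measurable_loopsAt n j))
    ((measurable_of_countable (geomShift c hc F)).comp (hs.measurable_loopsAt n j))

lemma abs_evalAt_le {Ω : Type*} {Wseq U : ℕ → Ω → ℝ} (c : ℝ) (hc : 0 < c) {F : ℕ → ℝ} {C : ℝ} (hF : ∀ l, |F l| ≤ C) (n j : ℕ)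
    (ω : Ω) : |evalAt c hc F Wseq U n j ω| ≤ C := by
  unfold evalAt
  split_ifs
  · exact hF _
  · exact abs_geomShift_le c hc hF _

lemma IsBernoulliSieve.integrable_evalAt [IsProbabilityMeasure P]
    (hs : IsBernoulliSieve P₀ W P Wseq U) (c : ℝ) (hc : 0 < c)
    {F : ℕ → ℝ} {C : ℝ} (hF : ∀ l, |F l| ≤ C) (n j : ℕ) :
    Integrable (evalAt c hc F Wseq U n j) P :=
  Integrable.of_bound (hs.measurable_evalAt c hc F n j).aestronglyMeasurable C
    (ae_of_all _ fun ω => abs_evalAt_le c hc hF n j ω)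

lemma evalAt_succ_sub {Ω : Type*} {Wseq U : ℕ → Ω → ℝ} {ω : Ω} (hω : ∀ k, Wseq k ω ∈ Set.Ioo (0 : ℝ) 1) (c : ℝ) (hc : 0 < c)
    (F : ℕ → ℝ) (n j : ℕ) :
    evalAt c hc F Wseq U n (j + 1) ω - evalAt c hc F Wseq U n j ω
      = ∑ A ∈ nonemptySets n,
        (({ω | remainingAt Wseq U n j ω = A} ∩ {ω | remainingAt Wseq U n (j + 1) ω = A}).indicator
          (fun ω => geomShift c hc F (loopsAt Wseq U n j ω + 1)
            - geomShift c hc F (loopsAt Wseq U n j ω)) ω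
        + ({ω | remainingAt Wseq U n j ω = A} ∩ {ω | remainingAt Wseq U n (j + 1) ω = ∅}).indicator
          (fun ω => F (loopsAt Wseq U n j ω) - geomShift c hc F (loopsAt Wseq U n j ω)) ω) := by
  classical
  have hl : loopsAt Wseq U n (j + 1) ω = loopsAt Wseq U n j ω +
      if (remainingAt Wseq U n j ω).Nonempty ∧
        remainingAt Wseq U n (j + 1) ω = remainingAt Wseq U n j ω then 1 else 0 :=
    loops_succ _ _ _ _
  have hanti : remainingAt Wseq U n (j + 1) ω ⊆ remainingAt Wseq U n j ω :=
    remaining_antitone hω (Nat.le_succ j)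
  have hsub : remainingAt Wseq U n j ω ⊆ Finset.range n := remaining_subset_range _ _ _ _
  simp only [evalAt, hl]
  by_cases hR : remainingAt Wseq U n j ω = ∅
  · have hR' : remainingAt Wseq U n (j + 1) ω = ∅ := by
      rw [hR] at hanti
      exact Finset.subset_empty.1 hanti
    rw [Finset.sum_eq_zero]
    · simp [hR, hR']
    · intro A hA
      have hne : ω ∉ {ω | remainingAt Wseq U n j ω = A} := fun h =>
        (mem_nonemptySets.1 hA).1 (Eq.trans (Eq.symm h) hR)
      rw [Set.indicator_of_notMem fun h => hne h.1, Set.indicator_of_notMem fun h => hne h.1,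
        add_zero]
  · rw [Finset.sum_eq_single (remainingAt Wseq U n j ω)]
    · by_cases h1 : remainingAt Wseq U n (j + 1) ω = ∅
      · have h2 : remainingAt Wseq U n (j + 1) ω ≠ remainingAt Wseq U n j ω := by
          rw [h1]; exact Ne.symm hR
        have h3 : ω ∈ {ω' | remainingAt Wseq U n j ω' = remainingAt Wseq U n j ω} ∩
            {ω | remainingAt Wseq U n (j + 1) ω = ∅} := ⟨rfl, h1⟩
        rw [Set.indicator_of_notMem fun h => h2 h.2, Set.indicator_of_mem h3]
        simp [h1, hR, Ne.symm hR]
      · rw [Set.indicator_of_notMem (s := _ ∩ {ω | remainingAt Wseq U n (j + 1) ω = ∅})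
          fun h => h1 h.2]
        by_cases h2 : remainingAt Wseq U n (j + 1) ω = remainingAt Wseq U n j ω
        · have h3 : ω ∈ {ω' | remainingAt Wseq U n j ω' = remainingAt Wseq U n j ω} ∩
              {ω' | remainingAt Wseq U n (j + 1) ω' = remainingAt Wseq U n j ω} := ⟨rfl, h2⟩
          rw [Set.indicator_of_mem h3]
          simp [h2, hR, Finset.nonempty_iff_ne_empty]
        · rw [Set.indicator_of_notMem fun h => h2 h.2]
          simp [h1, h2, hR]
    · intro A _ hA
      have hne : ω ∉ {ω | remainingAt Wseq U n j ω = A} := fun h => hA (Eq.symm h)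
      rw [Set.indicator_of_notMem fun h => hne h.1, Set.indicator_of_notMem fun h => hne h.1,
        add_zero]
    · intro h
      exact absurd (mem_nonemptySets.2 ⟨hR, hsub⟩) h

/-- The drift in the state `A` is proportional to `E W^k - c E(1-W)^k` with `k = |A|`. -/
lemma IsBernoulliSieve.abs_integral_evalAt_succ_sub_le [IsProbabilityMeasure P]
    (hs : IsBernoulliSieve P₀ W P Wseq U) (c : ℝ) (hc : 0 < c)
    {F : ℕ → ℝ} {C : ℝ} (hF : ∀ l, |F l| ≤ C) (n j : ℕ) :
    |∫ ω, evalAt c hc F Wseq U n (j + 1) ω ∂P - ∫ ω, evalAt c hc F Wseq U n j ω ∂P|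
      ≤ 2 * C * ∑ A ∈ nonemptySets n,
        |∫ ω, W ω ^ A.card ∂P₀ - c * ∫ ω, (1 - W ω) ^ A.card ∂P₀| *
          P.real {ω | remainingAt Wseq U n j ω = A} := by
  set H := geomShift c hc F with hH
  have hHb : ∀ l, |H l| ≤ C := abs_geomShift_le c hc hF
  have hX := hs.measurable_loopsAt n j
  have hD1m : Measurable fun ω => H (loopsAt Wseq U n j ω + 1) - H (loopsAt Wseq U n j ω) :=
    (measurable_of_countable fun l => H (l + 1) - H l).comp hX
  have hD2m : Measurable fun ω => F (loopsAt Wseq U n j ω) - H (loopsAt Wseq U n j ω) :=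
    (measurable_of_countable fun l => F l - H l).comp hX
  have hb : ∀ x y : ℝ, |x| ≤ C → |y| ≤ C → ‖x - y‖ ≤ 2 * C := fun x y hx hy =>
    (norm_sub_le _ _).trans (by rw [Real.norm_eq_abs, Real.norm_eq_abs]; linarith)
  have hD1 : Integrable (fun ω => H (loopsAt Wseq U n j ω + 1) - H (loopsAt Wseq U n j ω)) P :=
    Integrable.of_bound hD1m.aestronglyMeasurable (2 * C) (ae_of_all _ fun ω =>
      hb _ _ (hHb _) (hHb _))
  have hD2 : Integrable (fun ω => F (loopsAt Wseq U n j ω) - H (loopsAt Wseq U n j ω)) P :=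
    Integrable.of_bound hD2m.aestronglyMeasurable (2 * C) (ae_of_all _ fun ω =>
      hb _ _ (hF _) (hHb _))
  have hms := hs.measurableSet_remainingAt
  rw [← integral_sub (hs.integrable_evalAt c hc hF n (j + 1)) (hs.integrable_evalAt c hc hF n j),
    integral_congr_ae (hs.ae_Wseq_mem.mono fun ω hω => evalAt_succ_sub (U := U) hω c hc F n j),
    integral_finsetSum]
  swap
  · exact fun A _ => (hD1.indicator ((hms n j A).inter (hms n (j + 1) A))).add
      (hD2.indicator ((hms n j A).inter (hms n (j + 1) ∅)))
  rw [Finset.mul_sum]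
  refine (Finset.abs_sum_le_sum_abs _ _).trans (Finset.sum_le_sum fun A hA => ?_)
  have hAn := (mem_nonemptySets.1 hA).2
  rw [integral_add (hD1.indicator ((hms n j A).inter (hms n (j + 1) A)))
    (hD2.indicator ((hms n j A).inter (hms n (j + 1) ∅))),
    integral_indicator ((hms n j A).inter (hms n (j + 1) A)),
    integral_indicator ((hms n j A).inter (hms n (j + 1) ∅)),
    hs.setIntegral_stay n j hAn (fun l => H (l + 1) - H l),
    hs.setIntegral_exit n j hAn (fun l => F l - H l)]
  have hrec : ∀ l, F l - H l = -c * (H (l + 1) - H l) := geomShift_rec c hc hF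
  simp_rw [hrec]
  rw [integral_const_mul]
  set I := ∫ ω in {ω | remainingAt Wseq U n j ω = A},
    (H (loopsAt Wseq U n j ω + 1) - H (loopsAt Wseq U n j ω)) ∂P with hI
  have hIb : |I| ≤ 2 * C * P.real {ω | remainingAt Wseq U n j ω = A} :=
    norm_setIntegral_le_of_norm_le_const (measure_lt_top _ _) fun ω _ => hb _ _ (hHb _) (hHb _)
  have hfac : ∀ a b : ℝ, a * I + b * (-c * I) = (a - c * b) * I := fun a b => by ring
  rw [hfac, abs_mul]
  calc _ ≤ |∫ ω, W ω ^ A.card ∂P₀ - c * ∫ ω, (1 - W ω) ^ A.card ∂P₀| *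
        (2 * C * P.real {ω | remainingAt Wseq U n j ω = A}) :=
        mul_le_mul_of_nonneg_left hIb (abs_nonneg _)
    _ = _ := by ring

lemma IsBernoulliSieve.integral_evalAt_zero [IsProbabilityMeasure P]
    (hs : IsBernoulliSieve P₀ W P Wseq U) (c : ℝ) (hc : 0 < c) (F : ℕ → ℝ) {n : ℕ} (hn : n ≠ 0) :
    ∫ ω, evalAt c hc F Wseq U n 0 ω ∂P = geomShift c hc F 0 := by
  have hU : ∀ᵐ ω ∂P, ∀ i, U i ω ≤ 1 := by
    rw [ae_all_iff]
    exact fun i => (ae_uniform_mem_Ioc (hs.measurable_U i) (hs.uniform_U i)).mono fun ω h => h.2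
  rw [integral_congr_ae (g := fun _ => geomShift c hc F 0)]
  · simp
  · filter_upwards [hU] with ω hω
    have h0 : remainingAt Wseq U n 0 ω = Finset.range n := remaining_zero hω
    have h1 : loopsAt Wseq U n 0 ω = 0 := by simp [loopsAt, loops]
    simp only [evalAt, h0, h1, Finset.range_eq_empty_iff, hn, if_false]

lemma IsBernoulliSieve.abs_integral_numEmpty_sub_evalAt_le [IsProbabilityMeasure P₀]
    [IsProbabilityMeasure P] (hs : IsBernoulliSieve P₀ W P Wseq U)
    (hpot : ∀ x, potential (P₀.map W) bump x ≠ ∞) (c : ℝ) (hc : 0 < c)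
    {F : ℕ → ℝ} {C : ℝ} (hF : ∀ l, |F l| ≤ C) (n J : ℕ) :
    |∫ ω, F (numEmpty (fun k => Wseq k ω) (fun k => U k ω) n) ∂P
        - ∫ ω, evalAt c hc F Wseq U n J ω ∂P|
      ≤ 2 * C * P.real {ω | remainingAt Wseq U n J ω ≠ ∅} := by
  have hint : Integrable (fun ω => F (numEmpty (fun k => Wseq k ω) (fun k => U k ω) n)) P :=
    Integrable.of_bound ((measurable_of_countable F).comp_aemeasurable
      (hs.aemeasurable_numEmpty hpot n)).aestronglyMeasurable C (ae_of_all _ fun ω => hF _)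
  have hms : MeasurableSet {ω | remainingAt Wseq U n J ω ≠ ∅} :=
    (hs.measurableSet_remainingAt n J ∅).compl
  rw [← integral_sub hint (hs.integrable_evalAt c hc hF n J)]
  have h1 : ∫ ω, {ω | remainingAt Wseq U n J ω ≠ ∅}.indicator (fun _ => 2 * C) ω ∂P
      = 2 * C * P.real {ω | remainingAt Wseq U n J ω ≠ ∅} := by
    rw [integral_indicator_const _ hms, smul_eq_mul, mul_comm]
  rw [← h1, ← Real.norm_eq_abs]
  refine norm_integral_le_of_norm_le ((integrable_const _).indicator hms) ?_
  filter_upwards [hs.ae_Wseq_mem] with ω hω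
  by_cases h : remainingAt Wseq U n J ω = ∅
  · have hmem : ω ∉ {ω | remainingAt Wseq U n J ω ≠ ∅} := fun h' => h' h
    rw [Set.indicator_of_notMem hmem, numEmpty_eq_loops hω h]
    simp [evalAt, h]
  · rw [Set.indicator_of_mem (by exact h)]
    refine (norm_sub_le _ _).trans ?_
    rw [Real.norm_eq_abs, Real.norm_eq_abs]
    linarith [hF (numEmpty (fun k => Wseq k ω) (fun k => U k ω) n),
      abs_evalAt_le (Wseq := Wseq) (U := U) c hc hF n J ω]

/-- The total drift. States with more than `K` balls contribute at most `ε` times the probability of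
an exit, and states with at most `K` balls are visited rarely. -/
lemma IsBernoulliSieve.exists_sum_drift_le [IsProbabilityMeasure P₀]
    [IsProbabilityMeasure P] (hs : IsBernoulliSieve P₀ W P Wseq U)
    (hpot : ∀ x, potential (P₀.map W) bump x ≠ ∞) {c : ℝ}
    (h : Tendsto (fun n : ℕ => (∫ ω, W ω ^ n ∂P₀) / (∫ ω, (1 - W ω) ^ n ∂P₀)) atTop (𝓝 c))
    {ε : ℝ} (hε : 0 < ε) :
    ∃ D : ℝ, ∀ n J : ℕ, ∑ j ∈ Finset.range J, ∑ A ∈ nonemptySets n,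
        |∫ ω, W ω ^ A.card ∂P₀ - c * ∫ ω, (1 - W ω) ^ A.card ∂P₀| *
          P.real {ω | remainingAt Wseq U n j ω = A}
      ≤ ε + D * (potential (P₀.map W) bump n).toReal := by
  set a : ℕ → ℝ := fun k => ∫ ω, W ω ^ k ∂P₀ with ha
  set b : ℕ → ℝ := fun k => ∫ ω, (1 - W ω) ^ k ∂P₀ with hb
  have hbpos : ∀ k, 0 < b k := fun k => integral_pow_pos_of_mem_Ioo
    (X := fun ω => 1 - W ω) (measurable_const.sub hs.measurable_W)
    (hs.mem_Ioo.mono fun ω hω => ⟨by linarith [hω.2], by linarith [hω.1]⟩) k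
  obtain ⟨K, hK⟩ := Metric.tendsto_atTop.1 h ε hε
  have hlarge : ∀ k, K ≤ k → |a k - c * b k| ≤ ε * b k := by
    intro k hk
    have h1 := hK k hk
    rw [Real.dist_eq, show (∫ ω, W ω ^ k ∂P₀) / (∫ ω, (1 - W ω) ^ k ∂P₀) - c
      = (a k - c * b k) / b k by
        rw [sub_div, mul_div_assoc, div_self (hbpos k).ne', mul_one], abs_div,
      abs_of_pos (hbpos k), div_lt_iff₀ (hbpos k)] at h1
    exact h1.le
  have hC : ∀ k, ∃ C : ℝ, 1 ≤ k → ∀ n J : ℕ,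
      ∑ j ∈ Finset.range J, ∑ A ∈ (Finset.range n).powersetCard k,
        P.real {ω | remainingAt Wseq U n j ω = A} ≤ C * (potential (P₀.map W) bump n).toReal := by
    intro k
    by_cases hk : 1 ≤ k
    · obtain ⟨C, hC⟩ := hs.sum_measureReal_le hpot hk
      exact ⟨C, fun _ => hC⟩
    · exact ⟨0, fun h => absurd h hk⟩
  choose C hC using hC
  refine ⟨∑ k ∈ Finset.Icc 1 K, |a k - c * b k| * C k, fun n J => ?_⟩
  have hsplit : ∀ j, ∑ A ∈ nonemptySets n, |a A.card - c * b A.card| *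
        P.real {ω | remainingAt Wseq U n j ω = A}
      ≤ ε * ∑ A ∈ nonemptySets n, b A.card * P.real {ω | remainingAt Wseq U n j ω = A}
        + ∑ k ∈ Finset.Icc 1 K, |a k - c * b k| *
          ∑ A ∈ (Finset.range n).powersetCard k, P.real {ω | remainingAt Wseq U n j ω = A} := by
    intro j
    rw [← Finset.sum_filter_add_sum_filter_not (nonemptySets n) (fun A => A.card ≤ K), add_comm]
    refine add_le_add ?_ ?_
    · rw [Finset.mul_sum]
      refine (Finset.sum_le_sum fun A hA => ?_).trans
        (Finset.sum_le_sum_of_subset_of_nonneg (Finset.filter_subset _ _) fun A _ _ =>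
          mul_nonneg hε.le (mul_nonneg (hbpos _).le measureReal_nonneg))
      rw [← mul_assoc]
      exact mul_le_mul_of_nonneg_right
        (hlarge _ (not_le.1 (Finset.mem_filter.1 hA).2).le) measureReal_nonneg
    · have hmaps : ∀ A ∈ (nonemptySets n).filter (fun A => A.card ≤ K),
          A.card ∈ Finset.Icc 1 K := by
        intro A hA
        rw [Finset.mem_filter, mem_nonemptySets] at hA
        exact Finset.mem_Icc.2 ⟨Finset.card_pos.2
          (Finset.nonempty_iff_ne_empty.2 hA.1.1), hA.2⟩
      rw [← Finset.sum_fiberwise_of_maps_to hmaps]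
      refine Finset.sum_le_sum fun k _ => ?_
      rw [Finset.mul_sum]
      refine (Finset.sum_le_sum (g := fun A => |a k - c * b k| *
        P.real {ω | remainingAt Wseq U n j ω = A}) fun A hA => ?_).trans
        (Finset.sum_le_sum_of_subset_of_nonneg (fun A hA => ?_) fun A _ _ =>
          mul_nonneg (abs_nonneg _) measureReal_nonneg)
      · rw [(Finset.mem_filter.1 hA).2]
      · simp only [Finset.mem_filter, mem_nonemptySets] at hA
        exact Finset.mem_powersetCard.2 ⟨hA.1.1.2, hA.2⟩
  refine (Finset.sum_le_sum fun j _ => hsplit j).trans ?_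
  rw [Finset.sum_add_distrib, ← Finset.mul_sum,
    Finset.sum_comm (s := Finset.range J) (t := Finset.Icc 1 K)]
  refine add_le_add (mul_le_of_le_one_right hε.le (hs.sum_exit_le_one n J)) ?_
  rw [Finset.sum_mul]
  refine Finset.sum_le_sum fun k hk => ?_
  rw [← Finset.mul_sum, mul_assoc]
  exact mul_le_mul_of_nonneg_left (hC k (Finset.mem_Icc.1 hk).1 n J) (abs_nonneg _)

theorem IsBernoulliSieve.tendsto_integral_numEmpty [IsProbabilityMeasure P₀]
    [IsProbabilityMeasure P] (hs : IsBernoulliSieve P₀ W P Wseq U)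
    (hpot : ∀ x, potential (P₀.map W) bump x ≠ ∞)
    (hpot0 : Tendsto (potential (P₀.map W) bump) atTop (𝓝 0)) (c : ℝ) (hc : 0 < c)
    (h : Tendsto (fun n : ℕ => (∫ ω, W ω ^ n ∂P₀) / (∫ ω, (1 - W ω) ^ n ∂P₀)) atTop (𝓝 c))
    {F : ℕ → ℝ} {C : ℝ} (hF : ∀ l, |F l| ≤ C) :
    Tendsto (fun n => ∫ ω, F (numEmpty (fun k => Wseq k ω) (fun k => U k ω) n) ∂P) atTop
      (𝓝 (∫ m, F m ∂geometricMeasure (successProb c hc))) := by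
  have hC0 : 0 ≤ C := (abs_nonneg _).trans (hF 0)
  have hH0 : geomShift c hc F 0 = ∫ m, F m ∂geometricMeasure (successProb c hc) := by
    simp [geomShift]
  rw [← hH0]
  have hpotr : Tendsto (fun n : ℕ => (potential (P₀.map W) bump n).toReal) atTop (𝓝 0) := by
    have h1 := (ENNReal.tendsto_toReal ENNReal.zero_ne_top).comp
      (hpot0.comp tendsto_natCast_atTop_atTop)
    simpa [Function.comp_def] using h1
  rw [Metric.tendsto_atTop']
  intro δ hδ
  set ε : ℝ := δ / (4 * (C + 1)) with hε
  have hε0 : 0 < ε := by positivity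
  obtain ⟨D, hD⟩ := hs.exists_sum_drift_le hpot h hε0
  have hbound : ∀ n : ℕ, n ≠ 0 →
      |∫ ω, F (numEmpty (fun k => Wseq k ω) (fun k => U k ω) n) ∂P - geomShift c hc F 0|
        ≤ 2 * C * (ε + D * (potential (P₀.map W) bump n).toReal) := by
    intro n hn
    have hJ : ∀ J : ℕ,
        |∫ ω, F (numEmpty (fun k => Wseq k ω) (fun k => U k ω) n) ∂P - geomShift c hc F 0|
        ≤ 2 * C * P.real {ω | remainingAt Wseq U n J ω ≠ ∅}
          + 2 * C * (ε + D * (potential (P₀.map W) bump n).toReal) := by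
      intro J
      refine (abs_sub_le _ (∫ ω, evalAt c hc F Wseq U n J ω ∂P) _).trans
        (add_le_add (hs.abs_integral_numEmpty_sub_evalAt_le hpot c hc hF n J) ?_)
      rw [← hs.integral_evalAt_zero c hc F hn,
        ← Finset.sum_range_sub (fun j => ∫ ω, evalAt c hc F Wseq U n j ω ∂P)]
      refine (Finset.abs_sum_le_sum_abs _ _).trans ((Finset.sum_le_sum fun j _ =>
        hs.abs_integral_evalAt_succ_sub_le c hc hF n j).trans ?_)
      rw [← Finset.mul_sum]
      exact mul_le_mul_of_nonneg_left (hD n J) (by positivity)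
    have hlim := ((hs.tendsto_measureReal_remaining hpot n).const_mul (2 * C)).add_const
      (2 * C * (ε + D * (potential (P₀.map W) bump n).toReal))
    rw [mul_zero, zero_add] at hlim
    exact ge_of_tendsto' hlim hJ
  have hlim : Tendsto (fun n : ℕ => 2 * C * (ε + D * (potential (P₀.map W) bump n).toReal)) atTop
      (𝓝 (2 * C * (ε + D * 0))) := ((hpotr.const_mul D).const_add ε).const_mul (2 * C)
  have hlt : 2 * C * (ε + D * 0) < δ := by
    have : ε * (4 * (C + 1)) = δ := by rw [hε]; field_simp
    nlinarith
  obtain ⟨N, hN⟩ := eventually_atTop.1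
    ((hlim.eventually (gt_mem_nhds hlt)).and (eventually_ne_atTop 0))
  refine ⟨N, fun n hn => ?_⟩
  rw [Real.dist_eq]
  exact (hbound n (hN n hn.le).2).trans_lt (hN n hn.le).1

/-- Convergence in distribution under the moment condition. -/
theorem IsBernoulliSieve.tendstoInDistribution_numEmpty [IsProbabilityMeasure P₀]
    [IsProbabilityMeasure P] (hs : IsBernoulliSieve P₀ W P Wseq U)
    (hpot : ∀ x, potential (P₀.map W) bump x ≠ ∞)
    (hpot0 : Tendsto (potential (P₀.map W) bump) atTop (𝓝 0)) (c : ℝ) (hc : 0 < c)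
    (h : Tendsto (fun n : ℕ => (∫ ω, W ω ^ n ∂P₀) / (∫ ω, (1 - W ω) ^ n ∂P₀)) atTop (𝓝 c)) :
    TendstoInDistribution
      (fun (n : ℕ) (ω : Ω) => numEmpty (fun k => Wseq k ω) (fun k => U k ω) n)
      atTop (id : ℕ → ℕ) (fun _ => P) (geometricMeasure (successProb c hc)) where
  forall_aemeasurable := hs.aemeasurable_numEmpty hpot
  aemeasurable_limit := aemeasurable_id
  tendsto := by
    refine ProbabilityMeasure.tendsto_iff_forall_integral_tendsto.2 fun f => ?_
    have hf : ∀ μ : Measure ℕ, AEStronglyMeasurable f μ := fun μ =>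
      (measurable_of_countable f).aestronglyMeasurable
    have h1 := hs.tendsto_integral_numEmpty hpot hpot0 c hc h (F := f) (C := ‖f‖)
      fun l => f.norm_coe_le_norm l
    simp only [ProbabilityMeasure.coe_mk, Measure.map_id]
    refine h1.congr fun n => ?_
    rw [integral_map (hs.aemeasurable_numEmpty hpot n) (hf _)]

end BernoulliSieve

theorem theorem1 {Ω₀ Ω : Type*} [MeasurableSpace Ω₀] [MeasurableSpace Ω]
    (P₀ : Measure Ω₀) [IsProbabilityMeasure P₀] (P : Measure Ω) [IsProbabilityMeasure P]
    (W : Ω₀ → ℝ) (Wseq U : ℕ → Ω → ℝ)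
    (hsieve : BernoulliSieve.IsBernoulliSieve P₀ W P Wseq U)
    (hmu : ∫⁻ ω, ENNReal.ofReal |Real.log (W ω)| ∂P₀ = ∞)
    (c : ℝ) (hc : 0 < c) :
    (Tendsto (fun n : ℕ => (∫ ω, (W ω) ^ n ∂P₀) / (∫ ω, (1 - W ω) ^ n ∂P₀)) atTop (𝓝 c) →
      TendstoInDistribution
        (fun (n : ℕ) (ω : Ω) =>
          BernoulliSieve.numEmpty (fun k => Wseq k ω) (fun k => U k ω) n)
        atTop (id : ℕ → ℕ) (fun _ => P)
        (geometricMeasure (BernoulliSieve.successProb c hc))) ∧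
    (Tendsto (fun x : ℝ => P₀.real {ω | 1 - W ω ≤ x} / P₀.real {ω | W ω ≤ x})
        (𝓝[>] 0) (𝓝 c) →
      TendstoInDistribution
        (fun (n : ℕ) (ω : Ω) =>
          BernoulliSieve.numEmpty (fun k => Wseq k ω) (fun k => U k ω) n)
        atTop (id : ℕ → ℕ) (fun _ => P)
        (geometricMeasure (BernoulliSieve.successProb c hc))) := by
  have hWm := hsieve.measurable_W
  have := Measure.isProbabilityMeasure_map (μ := P₀) hWm.aemeasurable
  have hν := hsieve.ae_mem_Ioo_map
  have hlog : ∫⁻ w, ENNReal.ofReal |Real.log w| ∂(P₀.map W) = ∞ := by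
    rw [lintegral_map (by fun_prop) hWm, hmu]
  have hpos : ∀ x > 0, 0 < P₀ {ω | W ω ≤ x} := fun x hx => by
    have h1 := BernoulliSieve.measure_Iic_pos hν hlog hx
    rwa [Measure.map_apply hWm measurableSet_Iic] at h1
  have hpot : ∀ x, BernoulliSieve.potential (P₀.map W) BernoulliSieve.bump x ≠ ∞ :=
    BernoulliSieve.potential_bump_ne_top hν hlog
  have hmain := hsieve.tendstoInDistribution_numEmpty hpot
    (BernoulliSieve.tendsto_potential_bump hν hlog) c hc
  exact ⟨hmain, fun h => hmain
    (BernoulliSieve.tendsto_moment_ratio_of_tendsto_tail_ratio hWm hsieve.mem_Ioo hpos hc h)⟩
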